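/- **Setting.** Let $1\le K$ and $n<p$ be integers. Consider the factor regression model $$X=AZ+E,\qquad y=Z^\top\beta+\varepsilon ,$$ with $A\in\mathbb R^{p\times K}$, $\beta\in\mathbb R^K$ deterministic, and $Z\in\mathbb R^K$, $E\in\mathbb R^p$, $\varepsilon\in\mathbb R$ mutually independent with mean zero and finite second moments. Write $\Sigma_Z,\Sigma_E,\Sigma_X$ for the covariance matrices of $Z,E,X$, $\Sigma_{Xy}=\mathbb E[Xy]$, $\sigma_\varepsilon^2=\mathrm{Var}(\varepsilon)$. Let $\lambda_1(Q)\ge\lambda_2(Q)\ge\cdots$ be the ordered eigenvalues of a symmetric matrix $Q$, $\|Q\|$ its operator norm, $B^+$ the Moore–Penrose pseudo-inverse of $B$, $\|v\|$ the Euclidean norm and $\|v\|_Q^2=v^\top Qv$. Put $$R(\alpha)=\mathbb E[(X^\top\alpha-y)^2],\qquad \alpha^*=\Sigma_X^+\Sigma_{Xy},\qquad \xi=\frac{\lambda_K(A\Sigma_ZA^\top)}{\|\Sigma_E\|},\qquad \kappa(\Sigma_E)=\frac{\lambda_1(\Sigma_E)}{\lambda_p(\Sigma_E)},$$ with $\xi^{-1}=0$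 if $\Sigma_E=0$. Let $(Z_i,E_i,\varepsilon_i)$, $i=1,\dots,n$, be i.i.d. copies of $(Z,E,\varepsilon)$, let $\mathbf X\in\mathbb R^{n\times p}$ have rows $X_i=AZ_i+E_i$ and let $\mathbf y\in\mathbb R^n$ have entries $y_i=Z_i^\top\beta+\varepsilon_i$. Let the columns of $U_K\in\mathbb R^{p\times K}$ be (any choice of) orthonormal eigenvectors of $\Sigma_X$ for its $K$ largest eigenvalues, and let $$\widetilde\alpha_{\rm PCR}=U_K(\mathbf XU_K)^+\mathbf y .$$ The risk $R(\widetilde\alpha_{\rm PCR})$ is the function $R$ evaluated at the (random) vector $\widetilde\alpha_{\rm PCR}$, that is, the expectation is over a new data point independent of the sample. **Theorem.** There are absolute constants $C,c,C'>0$ such that the following holds. Suppose that $(X,y)$ is jointly Gaussian, that $A$ and $\Sigma_Z$ both have rank $K$, and that $n>C\,K\log n$. Then, with probability at least $1-c/n$ over the sample, all of the following hold: 1. $\displaystyle R(\widetilde\alpha_{\rm PCR})-R(\alpha^*)\le C'\Big(\|\Sigma_E\|\,\|\alpha^*\|^2\,\frac pn+R(\alpha^*)\,\frac{K\log n}{n}\Big)$;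 2. $\displaystyle R(\widetilde\alpha_{\rm PCR})-\sigma_\varepsilon^2\le C'\Big(\big(1+\xi^{-1}\big)\|\Sigma_E\|\,\|\alpha^*\|^2\,\frac pn+R(\alpha^*)\,\frac{K\log n}{n}\Big)$ (so that, whenever $\xi$ is bounded below by a positive constant, the bound in 1 holds, up to a constant, also for the excess over $\sigma_\varepsilon^2$); 3. if $\Sigma_E=0$, then $\displaystyle R(\widetilde\alpha_{\rm PCR})-\sigma_\varepsilon^2\le C'\,\sigma_\varepsilon^2\,\frac{K\log n}{n}$; 4. if $\lambda_p(\Sigma_E)>0$, then $\displaystyle R(\widetilde\alpha_{\rm PCR})-\sigma_\varepsilon^2\le C'\Big(\kappa(\Sigma_E)\,\frac{\|\beta\|_{\Sigma_Z}^2}{\xi}\,\frac pn+\sigma_\varepsilon^2\,\frac{K\log n}{n}\Big)$. -/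

import Mathlib

open MeasureTheory ProbabilityTheory
open scoped Matrix ENNReal

noncomputable section

/-! ### Linear algebra: Moore–Penrose inverse, ordered eigenvalues, operator norm -/

/-- The four Penrose conditions: `C` is a Moore–Penrose pseudo-inverse of `B`. -/
structure IsMoorePenrose {n m : ℕ} (B : Matrix (Fin n) (Fin m) ℝ)
    (C : Matrix (Fin m) (Fin n) ℝ) : Prop where
  mul_mul_self : B * C * B = B
  mul_mul_inv : C * B * C = C
  symm_left : (B * C)ᵀ = B * C
  symm_right : (C * B)ᵀ = C * B

theorem exists_symm_pinv {m : ℕ} (G : Matrix (Fin m) (Fin m) ℝ) (hG : G.IsHermitian) :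
    ∃ P : Matrix (Fin m) (Fin m) ℝ,
      Pᵀ = P ∧ G * P * G = G ∧ P * G * P = P ∧ (P * G)ᵀ = P * G := by
  obtain ⟨U, l, hUU, hGs⟩ : ∃ (U : Matrix (Fin m) (Fin m) ℝ) (l : Fin m → ℝ),
      Uᵀ * U = 1 ∧ G = U * Matrix.diagonal l * Uᵀ := by
    refine ⟨(hG.eigenvectorUnitary : Matrix (Fin m) (Fin m) ℝ), hG.eigenvalues, ?_, ?_⟩
    · have h := Unitary.coe_star_mul_self hG.eigenvectorUnitary
      rw [Matrix.star_eq_conjTranspose, Matrix.conjTranspose_eq_transpose_of_trivial] at h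
      exact h
    · have h := hG.spectral_theorem
      rw [Unitary.conjStarAlgAut_apply, Matrix.star_eq_conjTranspose,
        Matrix.conjTranspose_eq_transpose_of_trivial] at h
      exact h
  have key : ∀ d e : Fin m → ℝ, (U * Matrix.diagonal d * Uᵀ) * (U * Matrix.diagonal e * Uᵀ)
      = U * Matrix.diagonal (fun i => d i * e i) * Uᵀ := by
    intro d e
    calc (U * Matrix.diagonal d * Uᵀ) * (U * Matrix.diagonal e * Uᵀ)
        = U * Matrix.diagonal d * (Uᵀ * U) * Matrix.diagonal e * Uᵀ := by
          simp only [Matrix.mul_assoc]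
      _ = U * Matrix.diagonal (fun i => d i * e i) * Uᵀ := by
          rw [hUU, Matrix.mul_one, Matrix.mul_assoc U, Matrix.diagonal_mul_diagonal]
  have hsym : ∀ d : Fin m → ℝ, (U * Matrix.diagonal d * Uᵀ)ᵀ = U * Matrix.diagonal d * Uᵀ := by
    intro d
    simp [Matrix.transpose_mul, Matrix.mul_assoc]
  refine ⟨U * Matrix.diagonal (fun i => (l i)⁻¹) * Uᵀ, hsym _, ?_, ?_, ?_⟩
  · rw [hGs, key, key]
    congr 3
    funext i
    exact mul_inv_mul_cancel _
  · rw [hGs, key, key]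
    congr 3
    funext i
    by_cases h : l i = 0
    · simp [h]
    · field_simp
  · rw [hGs, key, hsym]

theorem exists_isMoorePenrose {n m : ℕ} (B : Matrix (Fin n) (Fin m) ℝ) :
    ∃ C, IsMoorePenrose B C := by
  have hG : (Bᵀ * B).IsHermitian := by
    have h := Matrix.isHermitian_conjTranspose_mul_self B
    rwa [Matrix.conjTranspose_eq_transpose_of_trivial] at h
  obtain ⟨P, hP, h1, h2, h3⟩ := exists_symm_pinv (Bᵀ * B) hG
  have h0 : B * (P * (Bᵀ * B) - 1) = 0 := by
    have h : Bᵀ * B * (P * (Bᵀ * B) - 1) = 0 := by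
      rw [Matrix.mul_sub, Matrix.mul_one, ← Matrix.mul_assoc (Bᵀ * B) P, h1, sub_self]
    have h' := (Matrix.conjTranspose_mul_self_mul_eq_zero B (P * (Bᵀ * B) - 1)).1
    rw [Matrix.conjTranspose_eq_transpose_of_trivial] at h'
    exact h' h
  refine ⟨P * Bᵀ, ?_, ?_, ?_, ?_⟩
  · rw [Matrix.mul_sub, Matrix.mul_one, sub_eq_zero] at h0
    simpa only [Matrix.mul_assoc] using h0
  · calc P * Bᵀ * B * (P * Bᵀ) = P * (Bᵀ * B) * P * Bᵀ := by simp only [Matrix.mul_assoc]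
      _ = P * Bᵀ := by rw [h2]
  · simp [Matrix.transpose_mul, hP, Matrix.mul_assoc]
  · simpa only [Matrix.mul_assoc] using h3

/-- The Penrose conditions determine the pseudo-inverse uniquely. -/
theorem IsMoorePenrose.unique {n m : ℕ} {B : Matrix (Fin n) (Fin m) ℝ}
    {C D : Matrix (Fin m) (Fin n) ℝ} (hC : IsMoorePenrose B C) (hD : IsMoorePenrose B D) :
    C = D := by
  have hL : B * C = B * D := by
    calc B * C = (B * C)ᵀ := hC.symm_left.symm
      _ = (B * D * (B * C))ᵀ := by rw [← Matrix.mul_assoc, hD.mul_mul_self]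
      _ = B * C * (B * D) := by rw [Matrix.transpose_mul, hC.symm_left, hD.symm_left]
      _ = B * D := by rw [← Matrix.mul_assoc, hC.mul_mul_self]
  have hR : C * B = D * B := by
    calc C * B = (C * B)ᵀ := hC.symm_right.symm
      _ = (C * B * (D * B))ᵀ := by
          rw [Matrix.mul_assoc, ← Matrix.mul_assoc B, hD.mul_mul_self]
      _ = D * B * (C * B) := by rw [Matrix.transpose_mul, hC.symm_right, hD.symm_right]
      _ = D * B := by rw [Matrix.mul_assoc, ← Matrix.mul_assoc B, hC.mul_mul_self]
  calc C = C * B * C := hC.mul_mul_inv.symm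
    _ = D * (B * C) := by rw [hR, Matrix.mul_assoc]
    _ = D := by rw [hL, ← Matrix.mul_assoc, hD.mul_mul_inv]

/-- The Moore–Penrose pseudo-inverse `B⁺`. -/
def pinv {n m : ℕ} (B : Matrix (Fin n) (Fin m) ℝ) : Matrix (Fin m) (Fin n) ℝ :=
  Classical.choose (exists_isMoorePenrose B)

theorem isMoorePenrose_pinv {n m : ℕ} (B : Matrix (Fin n) (Fin m) ℝ) :
    IsMoorePenrose B (pinv B) :=
  Classical.choose_spec (exists_isMoorePenrose B)

/-- The `k`-th largest eigenvalue `λ_k(Q)`, `1 ≤ k ≤ d`, of a symmetric `d × d` matrix, counted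
with multiplicity. (The value is `0` for other `k` or if `Q` is not symmetric.) -/
def ordEig {d : ℕ} (Q : Matrix (Fin d) (Fin d) ℝ) (k : ℕ) : ℝ :=
  if h : Q.IsHermitian ∧ 1 ≤ k ∧ k ≤ d then
    h.1.eigenvalues₀ ⟨k - 1, by rw [Fintype.card_fin]; omega⟩
  else 0

/-- The operator norm of a square matrix with respect to the Euclidean norm. -/
def opNorm {d : ℕ} (Q : Matrix (Fin d) (Fin d) ℝ) : ℝ :=
  ‖Matrix.toEuclideanCLM (𝕜 := ℝ) Q‖

/-- The condition number `λ₁(Q) / λ_d(Q)`. -/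
def condNumber {d : ℕ} (Q : Matrix (Fin d) (Fin d) ℝ) : ℝ :=
  ordEig Q 1 / ordEig Q d

/-- The squared weighted norm `‖v‖²_Q = vᵀ Q v`. -/
def wNormSq {d : ℕ} (Q : Matrix (Fin d) (Fin d) ℝ) (v : Fin d → ℝ) : ℝ :=
  v ⬝ᵥ (Q *ᵥ v)

/-- The columns of `U` are orthonormal eigenvectors of `Q` for its `K` largest eigenvalues, in
decreasing order. -/
structure IsTopEigenvectors {p K : ℕ} (Q : Matrix (Fin p) (Fin p) ℝ)
    (U : Matrix (Fin p) (Fin K) ℝ) : Prop where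
  orthonormal : Uᵀ * U = 1
  eigen : Q * U = U * Matrix.diagonal (fun k : Fin K => ordEig Q ((k : ℕ) + 1))

/-- The covariance matrix of a random vector. -/
def covMat {Ω : Type*} [MeasurableSpace Ω] {d : ℕ} (V : Ω → Fin d → ℝ) (P : Measure Ω) :
    Matrix (Fin d) (Fin d) ℝ :=
  Matrix.of fun i j => cov[fun ω => V ω i, fun ω => V ω j; P]

/-- The principal-components regression estimator `U (𝐗 U)⁺ 𝐲`. -/
def pcrEstimator {n p K : ℕ} (U : Matrix (Fin p) (Fin K) ℝ) (X : Matrix (Fin n) (Fin p) ℝ)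
    (y : Fin n → ℝ) : Fin p → ℝ :=
  U *ᵥ (pinv (X * U) *ᵥ y)

/-! ### The factor regression model -/

/-- The factor regression model `X = A Z + E`, `y = Zᵀ β + ε`: the latent factor `Z` and the
noise terms `E`, `ε` are mutually independent, have mean zero and finite second moments. -/
structure FactorModel {Ω : Type*} [MeasurableSpace Ω] (P : Measure Ω) (p K : ℕ) where
  /-- loading matrix -/
  A : Matrix (Fin p) (Fin K) ℝ
  /-- latent regression vector -/
  β : Fin K → ℝ
  /-- latent factor -/
  Z : Ω → Fin K → ℝ
  /-- feature noise -/
  E : Ω → Fin p → ℝ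
  /-- response noise -/
  ε : Ω → ℝ
  memLp_Z : MemLp Z 2 P
  memLp_E : MemLp E 2 P
  memLp_ε : MemLp ε 2 P
  mean_Z : ∀ k, ∫ ω, Z ω k ∂P = 0
  mean_E : ∀ j, ∫ ω, E ω j ∂P = 0
  mean_ε : ∫ ω, ε ω ∂P = 0
  indep_Z : IndepFun Z (fun ω => (E ω, ε ω)) P
  indep_E : IndepFun E ε P

namespace FactorModel

variable {Ω : Type*} [MeasurableSpace Ω] {P : Measure Ω} {p K : ℕ} (M : FactorModel P p K)

/-- The feature vector `X = A Z + E`. -/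
def X (ω : Ω) : Fin p → ℝ := M.A *ᵥ M.Z ω + M.E ω

/-- The response `y = Zᵀ β + ε`. -/
def y (ω : Ω) : ℝ := M.Z ω ⬝ᵥ M.β + M.ε ω

/-- `Σ_Z = Cov(Z)`. -/
def covZ : Matrix (Fin K) (Fin K) ℝ := covMat M.Z P

/-- `Σ_E = Cov(E)`. -/
def covE : Matrix (Fin p) (Fin p) ℝ := covMat M.E P

/-- `Σ_X = Cov(X)`. -/
def covX : Matrix (Fin p) (Fin p) ℝ := covMat M.X P

/-- `Σ_{Xy} = 𝔼[X y]`. -/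
def covXy : Fin p → ℝ := fun j => ∫ ω, M.X ω j * M.y ω ∂P

/-- `σ_ε² = Var(ε)`. -/
def noiseVar : ℝ := Var[M.ε; P]

/-- The prediction risk `R(α) = 𝔼[(Xᵀ α - y)²]` for a new data point `(X, y)`. -/
def risk (α : Fin p → ℝ) : ℝ := ∫ ω, (M.X ω ⬝ᵥ α - M.y ω) ^ 2 ∂P

/-- The best linear predictor `α* = Σ_X⁺ Σ_{Xy}`. -/
def bestLinear : Fin p → ℝ := pinv M.covX *ᵥ M.covXy

/-- The signal-to-noise ratio `ξ = λ_K(A Σ_Z Aᵀ) / ‖Σ_E‖` (meant for `Σ_E ≠ 0`). -/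
def snr : ℝ := ordEig (M.A * M.covZ * M.Aᵀ) K / opNorm M.covE

/-- Both `A` and `Σ_Z` have full rank `K`. -/
def FullRank : Prop := M.A.rank = K ∧ M.covZ.rank = K

/-- `(Z_i, E_i, ε_i)`, `i = 1, …, n`, are i.i.d. copies of `(Z, E, ε)`. -/
structure IsSample {Ω' : Type*} [MeasurableSpace Ω'] (μ : Measure Ω') {n : ℕ}
    (Zs : Fin n → Ω' → Fin K → ℝ) (Es : Fin n → Ω' → Fin p → ℝ) (εs : Fin n → Ω' → ℝ) :
    Prop where
  indep : iIndepFun (fun i ω => (Zs i ω, Es i ω, εs i ω)) μ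
  identDistrib : ∀ i, IdentDistrib (fun ω => (Zs i ω, Es i ω, εs i ω))
    (fun ω => (M.Z ω, M.E ω, M.ε ω)) μ P

/-- The `n × p` data matrix, with rows `X_i = A Z_i + E_i`. -/
def dataX {n : ℕ} (z : Fin n → Fin K → ℝ) (e : Fin n → Fin p → ℝ) :
    Matrix (Fin n) (Fin p) ℝ :=
  Matrix.of fun i => M.A *ᵥ z i + e i

/-- The response vector, with entries `y_i = Z_iᵀ β + ε_i`. -/
def dataY {n : ℕ} (z : Fin n → Fin K → ℝ) (e : Fin n → ℝ) : Fin n → ℝ :=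
  fun i => z i ⬝ᵥ M.β + e i

/-- The risk, given the sample, of the principal-components regression estimator that is computed
from the sample with the `p × K` matrix `U`. -/
def pcrRisk (U : Matrix (Fin p) (Fin K) ℝ) {Ω' : Type*} {n : ℕ} (Zs : Fin n → Ω' → Fin K → ℝ)
    (Es : Fin n → Ω' → Fin p → ℝ) (εs : Fin n → Ω' → ℝ) (ω : Ω') : ℝ :=
  M.risk (pcrEstimator U (M.dataX (fun i => Zs i ω) (fun i => Es i ω))
    (M.dataY (fun i => Zs i ω) (fun i => εs i ω)))

end FactorModel

end

/-!
Write `Π = U Uᵀ` for the projection onto the top `K` eigenvectors of `Σ_X`. Normalising the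
coordinates `Uᵀ X` by the square roots of the eigenvalues gives a standard Gaussian vector that is
uncorrelated with the residual `y - Xᵀ Π α*`, because `U` diagonalises `Σ_X`. In these coordinates
`R(α̃) - R(Π α*)` is the squared norm of the least squares error. Once the empirical Gram matrix is
bounded below by a multiple of `n`, this is at most a constant times the squared norm of `n⁻¹` times
the empirical correlations of residual and features. Both the Gram matrix and the correlations are
controlled by the concentration of `∑ (X_iᵀ θ - b y_i)²`, a multiple of a `χ²` variable: the Gram
matrix by a union bound over a grid of the cube, the correlations by polarisation. Hence
`R(α̃) ≤ R(Π α*) (1 + O(K log n / n))`.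

The remaining bounds are deterministic. Since `A Σ_Z Aᵀ` has rank `K`, `λ_{K+1}(Σ_X) ≤ ‖Σ_E‖`, so
the truncation costs `R(Π α*) - R(α*) ≤ ‖Σ_E‖ ‖α*‖²`. The excess of `R(α*)` over the noise
variance is read off the normal equations, or from comparison with a minimal solution of `Aᵀ α = β`.
-/

section

/-! ### Ordered eigenvalues -/

theorem dotProduct_self_eq_sum_sq {ι : Type*} [Fintype ι] (x : ι → ℝ) :
    x ⬝ᵥ x = ∑ i, x i ^ 2 := by
  simp only [dotProduct, sq]

theorem dotProduct_self_nonneg {ι : Type*} [Fintype ι] (x : ι → ℝ) : 0 ≤ x ⬝ᵥ x :=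
  dotProduct_self_star_nonneg x

theorem dotProduct_self_pos {ι : Type*} [Fintype ι] {x : ι → ℝ} (hx : x ≠ 0) : 0 < x ⬝ᵥ x :=
  Matrix.dotProduct_self_star_pos_iff.2 hx

theorem dotProduct_mulVec_transpose {m k : Type*} [Fintype m] [Fintype k] (B : Matrix m k ℝ)
    (x : m → ℝ) (y : k → ℝ) : x ⬝ᵥ (B *ᵥ y) = (Bᵀ *ᵥ x) ⬝ᵥ y := by
  rw [Matrix.dotProduct_mulVec, Matrix.mulVec_transpose]

theorem sum_mul_sq_le_sum_mul_sq {ι : Type*} [Fintype ι] {a b : ι → ℝ} (h : ∀ i, a i ≤ b i)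
    (c : ι → ℝ) : ∑ i, a i * c i ^ 2 ≤ ∑ i, b i * c i ^ 2 :=
  Finset.sum_le_sum fun i _ => mul_le_mul_of_nonneg_right (h i) (sq_nonneg (c i))

theorem wNormSq_nonneg {d : ℕ} {Q : Matrix (Fin d) (Fin d) ℝ} (hQ : Q.PosSemidef)
    (x : Fin d → ℝ) : 0 ≤ wNormSq Q x :=
  hQ.dotProduct_mulVec_nonneg x

theorem ordEig_antitone {d : ℕ} {Q : Matrix (Fin d) (Fin d) ℝ} (hQ : Q.IsHermitian) {i j : ℕ}
    (hi : 1 ≤ i) (hij : i ≤ j) (hj : j ≤ d) : ordEig Q j ≤ ordEig Q i := by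
  unfold ordEig
  rw [dif_pos ⟨hQ, hi.trans hij, hj⟩, dif_pos ⟨hQ, hi, hij.trans hj⟩]
  exact hQ.eigenvalues₀_antitone (Fin.mk_le_mk.2 (Nat.sub_le_sub_right hij 1))

theorem ordEig_eq_zero_of_lt {d : ℕ} (Q : Matrix (Fin d) (Fin d) ℝ) {k : ℕ} (hk : d < k) :
    ordEig Q k = 0 :=
  dif_neg fun h => hk.not_ge h.2.2

theorem exists_mulVec_eq_zero_of_lt {k m : ℕ} (B : Matrix (Fin k) (Fin m) ℝ) (h : k < m) :
    ∃ c ≠ 0, B *ᵥ c = 0 := by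
  obtain ⟨c, hc, hc0⟩ := Submodule.exists_mem_ne_zero_of_ne_bot
    (LinearMap.ker_ne_bot_of_finrank_lt (f := B.mulVecLin) (by simpa using h))
  exact ⟨c, hc0, hc⟩

namespace IsTopEigenvectors

variable {d K : ℕ} {Q : Matrix (Fin d) (Fin d) ℝ} {U : Matrix (Fin d) (Fin K) ℝ}

theorem of_col (horth : ∀ k l, U.col k ⬝ᵥ U.col l = if k = l then 1 else 0)
    (heig : ∀ k : Fin K, Q *ᵥ U.col k = ordEig Q (k + 1) • U.col k) : IsTopEigenvectors Q U where
  orthonormal := by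
    ext k l
    rw [Matrix.one_apply]
    exact horth k l
  eigen := by
    ext i k
    rw [Matrix.mul_diagonal, mul_comm]
    exact congrFun (heig k) i

theorem col_dotProduct_col (hU : IsTopEigenvectors Q U) (k l : Fin K) :
    U.col k ⬝ᵥ U.col l = if k = l then 1 else 0 := by
  rw [← Matrix.one_apply, ← hU.orthonormal]
  rfl

theorem mulVec_col (hU : IsTopEigenvectors Q U) (k : Fin K) :
    Q *ᵥ U.col k = ordEig Q (k + 1) • U.col k := by
  ext i
  have h := congrFun (congrFun hU.eigen i) k
  rwa [Matrix.mul_diagonal, mul_comm] at h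

theorem transpose_mulVec_mulVec (hU : IsTopEigenvectors Q U) (c : Fin K → ℝ) :
    Uᵀ *ᵥ (U *ᵥ c) = c := by
  rw [Matrix.mulVec_mulVec, hU.orthonormal, Matrix.one_mulVec]

theorem mulVec_mulVec (hU : IsTopEigenvectors Q U) (c : Fin K → ℝ) :
    Q *ᵥ (U *ᵥ c) = U *ᵥ fun k : Fin K => ordEig Q (k + 1) * c k := by
  rw [Matrix.mulVec_mulVec, hU.eigen, ← Matrix.mulVec_mulVec]
  congr 1
  ext k
  rw [Matrix.mulVec_diagonal]

theorem mulVec_dotProduct_mulVec (hU : IsTopEigenvectors Q U) (c c' : Fin K → ℝ) :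
    (U *ᵥ c) ⬝ᵥ (U *ᵥ c') = c ⬝ᵥ c' := by
  rw [dotProduct_mulVec_transpose, hU.transpose_mulVec_mulVec]

theorem wNormSq_mulVec (hU : IsTopEigenvectors Q U) (c : Fin K → ℝ) :
    wNormSq Q (U *ᵥ c) = ∑ k : Fin K, ordEig Q (k + 1) * c k ^ 2 := by
  rw [wNormSq, hU.mulVec_mulVec, hU.mulVec_dotProduct_mulVec]
  exact Finset.sum_congr rfl fun k _ => by ring

theorem le (hU : IsTopEigenvectors Q U) : K ≤ d := by
  by_contra! hK
  obtain ⟨c, hc, hUc⟩ := exists_mulVec_eq_zero_of_lt U hK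
  exact hc (by rw [← hU.transpose_mulVec_mulVec c, hUc, Matrix.mulVec_zero])

theorem mulVec_transpose_mulVec {V : Matrix (Fin d) (Fin d) ℝ} (hV : IsTopEigenvectors Q V)
    (x : Fin d → ℝ) : V *ᵥ (Vᵀ *ᵥ x) = x := by
  rw [Matrix.mulVec_mulVec, mul_eq_one_comm.1 hV.orthonormal, Matrix.one_mulVec]

end IsTopEigenvectors

variable {d K : ℕ} {Q : Matrix (Fin d) (Fin d) ℝ}

theorem exists_isTopEigenvectors (hQ : Q.IsHermitian) (hK : K ≤ d) :
    ∃ U : Matrix (Fin d) (Fin K) ℝ, IsTopEigenvectors Q U := by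
  let e : Fin (Fintype.card (Fin d)) ≃ Fin d := Fintype.equivOfCardEq (Fintype.card_fin _)
  let σ : Fin K → Fin d := fun k => e ((Fin.castLE hK k).cast (Fintype.card_fin d).symm)
  have hσ : Function.Injective σ :=
    e.injective.comp ((Fin.cast_injective _).comp (Fin.castLE_injective hK))
  have hσeig (k : Fin K) : hQ.eigenvalues (σ k) = ordEig Q (k + 1) := by
    rw [ordEig, dif_pos ⟨hQ, by omega, by omega⟩, Matrix.IsHermitian.eigenvalues]
    exact congrArg hQ.eigenvalues₀ (e.symm_apply_apply _)
  refine ⟨Matrix.of fun i k => hQ.eigenvectorBasis (σ k) i, .of_col (fun k l => ?_) fun k => ?_⟩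
  · have h := orthonormal_iff_ite.1 hQ.eigenvectorBasis.orthonormal (σ l) (σ k)
    simpa [hσ.eq_iff, eq_comm, PiLp.inner_apply, dotProduct, Matrix.col_apply] using h
  · rw [← hσeig]
    exact hQ.mulVec_eigenvectorBasis (σ k)

theorem ordEig_nonneg (hQ : Q.PosSemidef) (k : ℕ) : 0 ≤ ordEig Q k := by
  unfold ordEig
  split_ifs with h
  · have hpos := hQ.eigenvalues_nonneg (Fintype.equivOfCardEq (Fintype.card_fin _)
      ⟨k - 1, by rw [Fintype.card_fin]; omega⟩)
    rwa [Matrix.IsHermitian.eigenvalues, Equiv.symm_apply_apply] at hpos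
  · exact le_rfl

theorem condNumber_nonneg (hQ : Q.PosSemidef) : 0 ≤ condNumber Q :=
  div_nonneg (ordEig_nonneg hQ 1) (ordEig_nonneg hQ d)

theorem one_le_condNumber (hQ : Q.IsHermitian) (hd : 1 ≤ d) (h : 0 < ordEig Q d) :
    1 ≤ condNumber Q :=
  (one_le_div h).2 (ordEig_antitone hQ le_rfl hd le_rfl)

theorem ordEig_last_mul_le_wNormSq (hQ : Q.IsHermitian) (x : Fin d → ℝ) :
    ordEig Q d * (x ⬝ᵥ x) ≤ wNormSq Q x := by
  obtain ⟨V, hV⟩ := exists_isTopEigenvectors hQ le_rfl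
  rw [← hV.mulVec_transpose_mulVec x, hV.wNormSq_mulVec, hV.mulVec_dotProduct_mulVec,
    dotProduct_self_eq_sum_sq, Finset.mul_sum]
  exact sum_mul_sq_le_sum_mul_sq (fun j => ordEig_antitone hQ (by omega) j.isLt le_rfl) _

theorem ordEig_mul_ordEig_le_sq (hQ : Q.PosSemidef) (hK : ordEig Q (K + 1) ≤ 0) (j : Fin d) :
    ordEig Q K * ordEig Q (j + 1) ≤ ordEig Q (j + 1) ^ 2 := by
  have h0 := ordEig_nonneg hQ (j + 1)
  rw [sq]
  rcases lt_or_ge (j : ℕ) K with hj | hj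
  · rcases le_or_gt K d with hKd | hKd
    · exact mul_le_mul_of_nonneg_right (ordEig_antitone hQ.1 (by omega) hj hKd) h0
    · simpa [ordEig_eq_zero_of_lt Q hKd] using mul_nonneg h0 h0
  · have hle := ordEig_antitone hQ.1 (i := K + 1) (j := j + 1) (by omega) (by omega) (by omega)
    simp [le_antisymm (hle.trans hK) h0]

theorem ordEig_mul_wNormSq_le (hQ : Q.PosSemidef) (hK : ordEig Q (K + 1) ≤ 0) (x : Fin d → ℝ) :
    ordEig Q K * wNormSq Q x ≤ (Q *ᵥ x) ⬝ᵥ (Q *ᵥ x) := by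
  obtain ⟨V, hV⟩ := exists_isTopEigenvectors hQ.1 le_rfl
  rw [← hV.mulVec_transpose_mulVec x, hV.wNormSq_mulVec, hV.mulVec_mulVec,
    hV.mulVec_dotProduct_mulVec, dotProduct_self_eq_sum_sq, Finset.mul_sum]
  simp only [← mul_assoc, mul_pow]
  exact sum_mul_sq_le_sum_mul_sq (ordEig_mul_ordEig_le_sq hQ hK) _

theorem ordEig_mul_mulVec_sq_le (hQ : Q.PosSemidef) (hK : ordEig Q (K + 1) ≤ 0)
    (x : Fin d → ℝ) :
    ordEig Q K * ((Q *ᵥ x) ⬝ᵥ (Q *ᵥ x)) ≤ wNormSq Q (Q *ᵥ x) := by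
  obtain ⟨V, hV⟩ := exists_isTopEigenvectors hQ.1 le_rfl
  rw [← hV.mulVec_transpose_mulVec x, hV.mulVec_mulVec, hV.wNormSq_mulVec,
    hV.mulVec_dotProduct_mulVec, dotProduct_self_eq_sum_sq, Finset.mul_sum]
  refine Finset.sum_le_sum fun j _ => ?_
  have h := mul_le_mul_of_nonneg_left (ordEig_mul_ordEig_le_sq hQ hK j) (ordEig_nonneg hQ (j + 1))
  calc _ = ordEig Q (j + 1) * (ordEig Q K * ordEig Q (j + 1)) * (Vᵀ *ᵥ x) j ^ 2 := by ring
    _ ≤ _ := mul_le_mul_of_nonneg_right h (sq_nonneg _)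
    _ = _ := by ring

/-! ### Courant–Fischer bounds -/

open Classical in
/-- Above the threshold `λ_{K+1}`, the columns of a full eigenbasis can be exchanged for those of
`U`: eigenvectors for distinct eigenvalues are orthogonal. -/
theorem IsTopEigenvectors.exists_extension {U : Matrix (Fin d) (Fin K) ℝ}
    (hU : IsTopEigenvectors Q U) (hQ : Q.IsHermitian) :
    ∃ V : Matrix (Fin d) (Fin d) ℝ, IsTopEigenvectors Q V ∧
      ∀ j : Fin d, ordEig Q (K + 1) < ordEig Q (j + 1) → ∃ k : Fin K, V.col j = U.col k := by
  obtain ⟨V, hV⟩ := exists_isTopEigenvectors hQ le_rfl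
  have hlt (j : Fin d) (hj : ordEig Q (K + 1) < ordEig Q (j + 1)) : (j : ℕ) < K := by
    by_contra! hKj
    exact hj.not_ge (ordEig_antitone hQ (by omega) (by omega) (by omega))
  have hcross (k : Fin K) (j : Fin d) (hkj : ordEig Q (k + 1) ≠ ordEig Q (j + 1)) :
      U.col k ⬝ᵥ V.col j = 0 := by
    have h := dotProduct_mulVec_transpose Q (U.col k) (V.col j)
    rw [Matrix.isHermitian_iff_isSymm.1 hQ, hU.mulVec_col, hV.mulVec_col, smul_dotProduct,
      dotProduct_smul, smul_eq_mul, smul_eq_mul] at h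
    exact (mul_eq_mul_right_iff.1 h).resolve_left hkj.symm
  let W : Fin d → Fin d → ℝ := fun j =>
    if hj : ordEig Q (K + 1) < ordEig Q (j + 1) then U.col ⟨j, hlt j hj⟩ else V.col j
  refine ⟨(Matrix.of W)ᵀ, .of_col (fun i j => ?_) fun j => ?_, fun j hj =>
    ⟨⟨j, hlt j hj⟩, dif_pos hj⟩⟩
  · change W i ⬝ᵥ W j = _
    by_cases hi : ordEig Q (K + 1) < ordEig Q (i + 1) <;>
      by_cases hj : ordEig Q (K + 1) < ordEig Q (j + 1) <;>
      simp only [W, dif_pos, dif_neg, hi, hj, not_false_eq_true]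
    · simp [hU.col_dotProduct_col, Fin.ext_iff]
    · have hne : ordEig Q (i + 1) ≠ ordEig Q (j + 1) := fun h => hj (h ▸ hi)
      rw [hcross _ _ hne, if_neg fun h : i = j => hne (by rw [h])]
    · have hne : ordEig Q (j + 1) ≠ ordEig Q (i + 1) := fun h => hi (h ▸ hj)
      rw [dotProduct_comm, hcross _ _ hne, if_neg fun h : i = j => hne (by rw [h])]
    · exact hV.col_dotProduct_col i j
  · change Q *ᵥ W j = ordEig Q (j + 1) • W j
    by_cases hj : ordEig Q (K + 1) < ordEig Q (j + 1)
    · simp only [W, dif_pos hj, hU.mulVec_col]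
    · simp only [W, dif_neg hj, hV.mulVec_col]

theorem IsTopEigenvectors.wNormSq_le_of_transpose_mulVec_eq_zero
    {U : Matrix (Fin d) (Fin K) ℝ} (hU : IsTopEigenvectors Q U) (hQ : Q.IsHermitian)
    {x : Fin d → ℝ} (hx : Uᵀ *ᵥ x = 0) : wNormSq Q x ≤ ordEig Q (K + 1) * (x ⬝ᵥ x) := by
  obtain ⟨V, hV, hVU⟩ := hU.exists_extension hQ
  rw [← hV.mulVec_transpose_mulVec x, hV.wNormSq_mulVec, hV.mulVec_dotProduct_mulVec,
    dotProduct_self_eq_sum_sq, Finset.mul_sum]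
  refine Finset.sum_le_sum fun j _ => ?_
  rcases le_or_gt (ordEig Q (j + 1)) (ordEig Q (K + 1)) with hj | hj
  · exact mul_le_mul_of_nonneg_right hj (sq_nonneg _)
  · obtain ⟨k, hk⟩ := hVU j hj
    have h0 : (Vᵀ *ᵥ x) j = 0 := (congrArg (· ⬝ᵥ x) hk).trans (congrFun hx k)
    simp [h0]

theorem ordEig_succ_le_of_forall_wNormSq_le (hQ : Q.IsHermitian) (B : Matrix (Fin d) (Fin K) ℝ)
    {s : ℝ} (hs : 0 ≤ s) (h : ∀ x, Bᵀ *ᵥ x = 0 → wNormSq Q x ≤ s * (x ⬝ᵥ x)) :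
    ordEig Q (K + 1) ≤ s := by
  rcases le_or_gt d K with hdK | hK
  · rwa [ordEig_eq_zero_of_lt Q (Nat.lt_succ_of_le hdK)]
  obtain ⟨U, hU⟩ := exists_isTopEigenvectors hQ (Nat.succ_le_of_lt hK)
  obtain ⟨c, hc, hBUc⟩ := exists_mulVec_eq_zero_of_lt (Bᵀ * U) K.lt_succ_self
  have hle := h (U *ᵥ c) (by rw [Matrix.mulVec_mulVec, hBUc])
  rw [hU.mulVec_dotProduct_mulVec, hU.wNormSq_mulVec] at hle
  refine le_of_mul_le_mul_right (le_trans ?_ hle) (dotProduct_self_pos hc)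
  rw [dotProduct_self_eq_sum_sq, Finset.mul_sum]
  exact sum_mul_sq_le_sum_mul_sq (fun k => ordEig_antitone hQ (by omega) k.isLt hK) _

theorem lt_ordEig_of_forall_lt_wNormSq (hQ : Q.IsHermitian) (W : Matrix (Fin d) (Fin K) ℝ)
    {s : ℝ} (h : ∀ c ≠ 0, s * ((W *ᵥ c) ⬝ᵥ (W *ᵥ c)) < wNormSq Q (W *ᵥ c)) (hK : 1 ≤ K) :
    s < ordEig Q K := by
  obtain ⟨k, rfl⟩ : ∃ k, K = k + 1 := ⟨K - 1, by omega⟩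
  have hkd : k + 1 ≤ d := by
    by_contra! hdk
    obtain ⟨c, hc, hWc⟩ := exists_mulVec_eq_zero_of_lt W hdk
    simpa [hWc, wNormSq] using h c hc
  obtain ⟨U, hU⟩ := exists_isTopEigenvectors hQ (k.le_succ.trans hkd)
  obtain ⟨c, hc, hUWc⟩ := exists_mulVec_eq_zero_of_lt (Uᵀ * W) k.lt_succ_self
  have hlt := (h c hc).trans_le
    (hU.wNormSq_le_of_transpose_mulVec_eq_zero hQ (by rw [Matrix.mulVec_mulVec, hUWc]))
  exact lt_of_mul_lt_mul_right hlt (dotProduct_self_nonneg _)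

/-! ### Operator norm and pseudo-inverse -/

theorem norm_toLp_sq (x : Fin d → ℝ) : ‖WithLp.toLp 2 x‖ ^ 2 = x ⬝ᵥ x := by
  rw [EuclideanSpace.real_norm_sq_eq, dotProduct_self_eq_sum_sq]

theorem opNorm_nonneg (Q : Matrix (Fin d) (Fin d) ℝ) : 0 ≤ opNorm Q := norm_nonneg _

theorem mulVec_sq_le_opNorm_sq_mul (Q : Matrix (Fin d) (Fin d) ℝ) (x : Fin d → ℝ) :
    (Q *ᵥ x) ⬝ᵥ (Q *ᵥ x) ≤ opNorm Q ^ 2 * (x ⬝ᵥ x) := by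
  have h := (Matrix.toEuclideanCLM (𝕜 := ℝ) Q).le_opNorm (WithLp.toLp 2 x)
  rw [Matrix.toEuclideanCLM_toLp] at h
  rw [← norm_toLp_sq, ← norm_toLp_sq, ← mul_pow]
  exact pow_le_pow_left₀ (norm_nonneg _) h 2

theorem wNormSq_le_opNorm_mul (Q : Matrix (Fin d) (Fin d) ℝ) (x : Fin d → ℝ) :
    wNormSq Q x ≤ opNorm Q * (x ⬝ᵥ x) := by
  calc wNormSq Q x
      = inner ℝ (Matrix.toEuclideanCLM (𝕜 := ℝ) Q (WithLp.toLp 2 x)) (WithLp.toLp 2 x) := by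
        rw [Matrix.toEuclideanCLM_toLp, EuclideanSpace.inner_toLp_toLp, star_trivial, wNormSq]
    _ ≤ ‖Matrix.toEuclideanCLM (𝕜 := ℝ) Q (WithLp.toLp 2 x)‖ * ‖WithLp.toLp 2 x‖ :=
        real_inner_le_norm _ _
    _ ≤ opNorm Q * ‖WithLp.toLp 2 x‖ * ‖WithLp.toLp 2 x‖ :=
        mul_le_mul_of_nonneg_right (ContinuousLinearMap.le_opNorm _ _) (norm_nonneg _)
    _ = opNorm Q * (x ⬝ᵥ x) := by rw [← norm_toLp_sq]; ring

theorem opNorm_le_ordEig_one (hQ : Q.PosSemidef) : opNorm Q ≤ ordEig Q 1 := by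
  obtain ⟨V, hV⟩ := exists_isTopEigenvectors hQ.1 le_rfl
  refine ContinuousLinearMap.opNorm_le_bound _ (ordEig_nonneg hQ 1) fun x => ?_
  refine le_of_sq_le_sq ?_ (mul_nonneg (ordEig_nonneg hQ 1) (norm_nonneg _))
  rw [mul_pow, ← WithLp.toLp_ofLp (p := 2) x, Matrix.toEuclideanCLM_toLp, norm_toLp_sq,
    norm_toLp_sq, ← hV.mulVec_transpose_mulVec x, hV.mulVec_mulVec, hV.mulVec_dotProduct_mulVec,
    hV.mulVec_dotProduct_mulVec, dotProduct_self_eq_sum_sq, dotProduct_self_eq_sum_sq,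
    Finset.mul_sum]
  simp only [mul_pow]
  exact sum_mul_sq_le_sum_mul_sq (fun j => pow_le_pow_left₀ (ordEig_nonneg hQ _)
    (ordEig_antitone hQ.1 le_rfl (by omega) j.isLt) 2) _

theorem transpose_mulVec_mulVec_pinv {n m : ℕ} (B : Matrix (Fin n) (Fin m) ℝ) (y : Fin n → ℝ) :
    Bᵀ *ᵥ (B *ᵥ (pinv B *ᵥ y)) = Bᵀ *ᵥ y := by
  have hB := isMoorePenrose_pinv B
  rw [Matrix.mulVec_mulVec, Matrix.mulVec_mulVec, Matrix.mul_assoc, ← hB.symm_left,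
    ← Matrix.transpose_mul, hB.mul_mul_self]

end

section

/-! ### Low-rank signal plus noise -/

variable {p K : ℕ} {A : Matrix (Fin p) (Fin K) ℝ} {G : Matrix (Fin K) (Fin K) ℝ}

theorem wNormSq_mul_mul_transpose (A : Matrix (Fin p) (Fin K) ℝ) (G : Matrix (Fin K) (Fin K) ℝ)
    (x : Fin p → ℝ) : wNormSq (A * G * Aᵀ) x = wNormSq G (Aᵀ *ᵥ x) := by
  rw [wNormSq, wNormSq, ← Matrix.mulVec_mulVec, ← Matrix.mulVec_mulVec,
    dotProduct_mulVec_transpose]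

theorem wNormSq_add (Q R : Matrix (Fin p) (Fin p) ℝ) (x : Fin p → ℝ) :
    wNormSq (Q + R) x = wNormSq Q x + wNormSq R x := by
  rw [wNormSq, Matrix.add_mulVec, dotProduct_add, wNormSq, wNormSq]

theorem wNormSq_sub {Q : Matrix (Fin p) (Fin p) ℝ} (hQ : Q.IsHermitian) (x y : Fin p → ℝ) :
    wNormSq Q (x - y) = wNormSq Q x - 2 * (x ⬝ᵥ (Q *ᵥ y)) + wNormSq Q y := by
  have hsymm : y ⬝ᵥ (Q *ᵥ x) = x ⬝ᵥ (Q *ᵥ y) := by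
    rw [dotProduct_mulVec_transpose, Matrix.isHermitian_iff_isSymm.1 hQ, dotProduct_comm]
  simp only [wNormSq, Matrix.mulVec_sub, sub_dotProduct, dotProduct_sub, hsymm]
  ring

theorem wNormSq_zero (Q : Matrix (Fin p) (Fin p) ℝ) : wNormSq Q 0 = 0 :=
  zero_dotProduct _

theorem wNormSq_pos (hG : G.PosDef) {x : Fin K → ℝ} (hx : x ≠ 0) : 0 < wNormSq G x :=
  hG.dotProduct_mulVec_pos hx

theorem posSemidef_mul_mul_transpose (A : Matrix (Fin p) (Fin K) ℝ) (hG : G.PosSemidef) :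
    (A * G * Aᵀ).PosSemidef := by
  simpa only [Matrix.conjTranspose_eq_transpose_of_trivial] using hG.mul_mul_conjTranspose_same A

theorem mulVec_injective_of_rank_eq (hA : A.rank = K) : Function.Injective A.mulVec := by
  rw [Matrix.mulVec_injective_iff, linearIndependent_iff_card_eq_finrank_span, Fintype.card_fin,
    Set.finrank, ← Matrix.rank_eq_finrank_span_cols, hA]

theorem transpose_mul_self_mulVec_injective (hA : Function.Injective A.mulVec) :
    Function.Injective (Aᵀ * A).mulVec := by
  rw [← Matrix.coe_mulVecLin, injective_iff_map_eq_zero]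
  intro c hc
  rw [Matrix.mulVecLin_apply, ← Matrix.conjTranspose_eq_transpose_of_trivial,
    Matrix.conjTranspose_mul_self_mulVec_eq_zero] at hc
  exact hA (hc.trans (Matrix.mulVec_zero A).symm)

theorem transpose_mul_self_mulVec_surjective (hA : Function.Injective A.mulVec) :
    Function.Surjective (Aᵀ * A).mulVec :=
  Matrix.mulVec_surjective_iff_isUnit.2
    (Matrix.mulVec_injective_iff_isUnit.1 (transpose_mul_self_mulVec_injective hA))

theorem transpose_mulVec_surjective (hA : Function.Injective A.mulVec) :
    Function.Surjective Aᵀ.mulVec := fun w => by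
  obtain ⟨c, hc⟩ := transpose_mul_self_mulVec_surjective hA w
  exact ⟨A *ᵥ c, by rw [Matrix.mulVec_mulVec, hc]⟩

theorem ordEig_succ_mul_mul_transpose_le (A : Matrix (Fin p) (Fin K) ℝ) (hG : G.PosSemidef) :
    ordEig (A * G * Aᵀ) (K + 1) ≤ 0 :=
  ordEig_succ_le_of_forall_wNormSq_le (posSemidef_mul_mul_transpose A hG).1 A le_rfl fun x hx => by
    rw [wNormSq_mul_mul_transpose, hx, wNormSq_zero, zero_mul]

theorem ordEig_mul_mul_transpose_pos (hA : Function.Injective A.mulVec) (hG : G.PosDef)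
    (hK : 1 ≤ K) : 0 < ordEig (A * G * Aᵀ) K := by
  refine lt_ordEig_of_forall_lt_wNormSq (posSemidef_mul_mul_transpose A hG.posSemidef).1 A
    (fun c hc => ?_) hK
  rw [zero_mul, wNormSq_mul_mul_transpose, Matrix.mulVec_mulVec]
  exact wNormSq_pos hG fun h =>
    hc (transpose_mul_self_mulVec_injective hA (h.trans (Matrix.mulVec_zero _).symm))

theorem ordEig_mul_wNormSq_le_mulVec_sq (hA : Function.Injective A.mulVec) (hG : G.PosSemidef)
    (w : Fin K → ℝ) :
    ordEig (A * G * Aᵀ) K * wNormSq G w ≤ (A *ᵥ (G *ᵥ w)) ⬝ᵥ (A *ᵥ (G *ᵥ w)) := by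
  obtain ⟨x, rfl⟩ := transpose_mulVec_surjective hA w
  have h := ordEig_mul_wNormSq_le (posSemidef_mul_mul_transpose A hG)
    (ordEig_succ_mul_mul_transpose_le A hG) x
  simpa only [wNormSq_mul_mul_transpose, ← Matrix.mulVec_mulVec] using h

theorem exists_transpose_mulVec_eq_and_ordEig_mul_le (hA : Function.Injective A.mulVec)
    (hG : G.PosDef) (b : Fin K → ℝ) :
    ∃ x, Aᵀ *ᵥ x = b ∧ ordEig (A * G * Aᵀ) K * (x ⬝ᵥ x) ≤ wNormSq G b := by
  obtain ⟨c, hc⟩ := transpose_mul_self_mulVec_surjective hA b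
  obtain ⟨v, rfl⟩ := Matrix.mulVec_surjective_iff_isUnit.2 hG.isUnit c
  obtain ⟨z, rfl⟩ := transpose_mulVec_surjective hA v
  have hx : Aᵀ *ᵥ ((A * G * Aᵀ) *ᵥ z) = b := by
    rw [← hc]
    simp only [Matrix.mulVec_mulVec, Matrix.mul_assoc]
  refine ⟨(A * G * Aᵀ) *ᵥ z, hx, ?_⟩
  have h := ordEig_mul_mulVec_sq_le (posSemidef_mul_mul_transpose A hG.posSemidef)
    (ordEig_succ_mul_mul_transpose_le A hG.posSemidef) z
  rwa [wNormSq_mul_mul_transpose, hx] at h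

theorem mulVec_pinv_mulVec_of_forall_dotProduct_eq_zero {Q : Matrix (Fin p) (Fin p) ℝ}
    (hQ : Q.IsHermitian) {b : Fin p → ℝ} (hb : ∀ z, Q *ᵥ z = 0 → z ⬝ᵥ b = 0) :
    Q *ᵥ (pinv Q *ᵥ b) = b := by
  have hr : Q *ᵥ (Q *ᵥ (pinv Q *ᵥ b) - b) = 0 := by
    have h := transpose_mulVec_mulVec_pinv Q b
    rw [Matrix.isHermitian_iff_isSymm.1 hQ] at h
    rw [Matrix.mulVec_sub, h, sub_self]
  have hrr : (Q *ᵥ (pinv Q *ᵥ b) - b) ⬝ᵥ (Q *ᵥ (pinv Q *ᵥ b) - b) = 0 := by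
    rw [dotProduct_sub, hb _ hr, sub_zero, dotProduct_mulVec_transpose,
      Matrix.isHermitian_iff_isSymm.1 hQ, hr, zero_dotProduct]
  exact sub_eq_zero.1 (dotProduct_self_eq_zero.1 hrr)

theorem IsTopEigenvectors.transpose_mulVec_projection_sub {Q : Matrix (Fin p) (Fin p) ℝ}
    {U : Matrix (Fin p) (Fin K) ℝ} (hU : IsTopEigenvectors Q U) (x : Fin p → ℝ) :
    Uᵀ *ᵥ (U *ᵥ (Uᵀ *ᵥ x) - x) = 0 := by
  rw [Matrix.mulVec_sub, hU.transpose_mulVec_mulVec, sub_self]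

theorem IsTopEigenvectors.projection_sub_dotProduct_self_le {Q : Matrix (Fin p) (Fin p) ℝ}
    {U : Matrix (Fin p) (Fin K) ℝ} (hU : IsTopEigenvectors Q U) (x : Fin p → ℝ) :
    (U *ᵥ (Uᵀ *ᵥ x) - x) ⬝ᵥ (U *ᵥ (Uᵀ *ᵥ x) - x) ≤ x ⬝ᵥ x := by
  have hx : x ⬝ᵥ (U *ᵥ (Uᵀ *ᵥ x)) = (Uᵀ *ᵥ x) ⬝ᵥ (Uᵀ *ᵥ x) := dotProduct_mulVec_transpose _ _ _
  rw [sub_dotProduct, dotProduct_sub, dotProduct_sub, hU.mulVec_dotProduct_mulVec, hx,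
    dotProduct_comm _ x, hx]
  linarith [dotProduct_self_nonneg (Uᵀ *ᵥ x)]

end

section

/-! ### Covariance matrices -/

variable {Ω : Type*} [MeasurableSpace Ω] {P : Measure Ω} {d : ℕ} {V : Ω → Fin d → ℝ}

theorem memLp_dotProduct (hV : MemLp V 2 P) (u : Fin d → ℝ) :
    MemLp (fun ω => V ω ⬝ᵥ u) 2 P :=
  memLp_finsetSum _ fun j _ => (hV.eval j).mul_const (u j)

theorem integral_dotProduct [IsFiniteMeasure P] (hV : MemLp V 2 P) (hV0 : ∀ j, ∫ ω, V ω j ∂P = 0)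
    (u : Fin d → ℝ) : ∫ ω, V ω ⬝ᵥ u ∂P = 0 := by
  simp only [dotProduct]
  rw [integral_finsetSum _ fun j _ => ((hV.eval j).mul_const (u j)).integrable one_le_two]
  simp only [integral_mul_const, hV0, zero_mul, Finset.sum_const_zero]

theorem covariance_dotProduct [IsFiniteMeasure P] (hV : MemLp V 2 P) (u w : Fin d → ℝ) :
    cov[fun ω => V ω ⬝ᵥ u, fun ω => V ω ⬝ᵥ w; P] = u ⬝ᵥ (covMat V P *ᵥ w) := by
  simp only [dotProduct, Matrix.mulVec, covMat, Matrix.of_apply]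
  rw [covariance_fun_sum_fun_sum (fun j => (hV.eval j).mul_const _)
    fun j => (hV.eval j).mul_const _]
  simp only [covariance_mul_const_left, covariance_mul_const_right, Finset.mul_sum]
  exact Finset.sum_congr rfl fun i _ => Finset.sum_congr rfl fun j _ => by ring

theorem variance_dotProduct [IsFiniteMeasure P] (hV : MemLp V 2 P) (u : Fin d → ℝ) :
    Var[fun ω => V ω ⬝ᵥ u; P] = wNormSq (covMat V P) u := by
  rw [← covariance_self (memLp_dotProduct hV u).aemeasurable, covariance_dotProduct hV, wNormSq]

theorem posSemidef_covMat [IsFiniteMeasure P] (hV : MemLp V 2 P) : (covMat V P).PosSemidef := by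
  refine .of_dotProduct_mulVec_nonneg (Matrix.IsHermitian.ext fun i j => covariance_comm _ _)
    fun u => ?_
  change 0 ≤ wNormSq (covMat V P) u
  rw [← variance_dotProduct hV]
  exact variance_nonneg _ _

theorem covMat_mulVec [IsFiniteMeasure P] (hV : MemLp V 2 P) {m : ℕ}
    (B : Matrix (Fin m) (Fin d) ℝ) :
    covMat (fun ω => B *ᵥ V ω) P = B * covMat V P * Bᵀ := by
  ext i j
  simp only [covMat, Matrix.of_apply, Matrix.mulVec, dotProduct_comm (B _)]
  rw [covariance_dotProduct hV, Matrix.mul_assoc]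
  rfl

theorem covMat_add_of_indepFun [IsFiniteMeasure P] {W : Ω → Fin d → ℝ} (hV : MemLp V 2 P)
    (hW : MemLp W 2 P) (hVW : IndepFun V W P) :
    covMat (fun ω => V ω + W ω) P = covMat V P + covMat W P := by
  have hcross (i j : Fin d) : cov[fun ω => V ω i, fun ω => W ω j; P] = 0 :=
    (hVW.comp (measurable_pi_apply i) (measurable_pi_apply j)).covariance_eq_zero
      (hV.eval i) (hW.eval j)
  ext i j
  change cov[(fun ω => V ω i) + fun ω => W ω i, (fun ω => V ω j) + fun ω => W ω j; P] =
    cov[fun ω => V ω i, fun ω => V ω j; P] + cov[fun ω => W ω i, fun ω => W ω j; P]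
  rw [covariance_add_left (hV.eval i) (hW.eval i) ((hV.eval j).add (hW.eval j)),
    covariance_add_right (hV.eval i) (hV.eval j) (hW.eval j),
    covariance_add_right (hW.eval i) (hV.eval j) (hW.eval j), hcross, add_zero,
    covariance_comm (fun ω => W ω i), hcross, zero_add]

end

namespace FactorModel

/-! ### The population risk -/

variable {Ω : Type*} [MeasurableSpace Ω] {P : Measure Ω} {p K : ℕ}
  {M : FactorModel P p K}

theorem FullRank.mulVec_injective (hM : M.FullRank) :
    Function.Injective M.A.mulVec :=
  mulVec_injective_of_rank_eq hM.1

variable (M)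

theorem memLp_mulVec_Z : MemLp (fun ω => M.A *ᵥ M.Z ω) 2 P :=
  .of_eval fun j => by
    simpa only [Matrix.mulVec, dotProduct_comm] using memLp_dotProduct M.memLp_Z (M.A j)

theorem memLp_X : MemLp M.X 2 P := M.memLp_mulVec_Z.add M.memLp_E

theorem memLp_y : MemLp M.y 2 P := (memLp_dotProduct M.memLp_Z M.β).add M.memLp_ε

theorem X_dotProduct (θ : Fin p → ℝ) (ω : Ω) :
    M.X ω ⬝ᵥ θ = M.Z ω ⬝ᵥ (M.Aᵀ *ᵥ θ) + M.E ω ⬝ᵥ θ := by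
  rw [X, add_dotProduct, dotProduct_comm (M.A *ᵥ _), dotProduct_mulVec_transpose, dotProduct_comm]

variable [IsProbabilityMeasure P]

theorem FullRank.posDef_covZ {M : FactorModel P p K} (hM : M.FullRank) :
    M.covZ.PosDef :=
  (posSemidef_covMat M.memLp_Z).posDef_iff_isUnit.2
    (Matrix.mulVec_injective_iff_isUnit.1 (mulVec_injective_of_rank_eq hM.2))

theorem posSemidef_covZ : M.covZ.PosSemidef := posSemidef_covMat M.memLp_Z

theorem posSemidef_covE : M.covE.PosSemidef := posSemidef_covMat M.memLp_E

theorem posSemidef_covX : M.covX.PosSemidef := posSemidef_covMat M.memLp_X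

theorem covX_eq : M.covX = M.A * M.covZ * M.Aᵀ + M.covE := by
  have hindep : IndepFun (fun ω => M.A *ᵥ M.Z ω) M.E P :=
    M.indep_Z.comp (φ := fun z => M.A *ᵥ z) (ψ := Prod.fst) (by fun_prop) measurable_fst
  exact (covMat_add_of_indepFun M.memLp_mulVec_Z M.memLp_E hindep).trans
    (congrArg (· + M.covE) (covMat_mulVec M.memLp_Z M.A))

theorem integral_X_dotProduct (θ : Fin p → ℝ) : ∫ ω, M.X ω ⬝ᵥ θ ∂P = 0 := by
  simp only [X_dotProduct]
  rw [integral_add ((memLp_dotProduct M.memLp_Z _).integrable one_le_two)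
    ((memLp_dotProduct M.memLp_E _).integrable one_le_two), integral_dotProduct M.memLp_Z M.mean_Z,
    integral_dotProduct M.memLp_E M.mean_E, add_zero]

theorem integral_y : ∫ ω, M.y ω ∂P = 0 := by
  simp only [y]
  rw [integral_add ((memLp_dotProduct M.memLp_Z _).integrable one_le_two)
    (M.memLp_ε.integrable one_le_two), integral_dotProduct M.memLp_Z M.mean_Z, M.mean_ε, add_zero]

theorem covXy_eq : M.covXy = M.A *ᵥ (M.covZ *ᵥ M.β) := by
  funext j
  have hXj : (fun ω => M.X ω j) = (fun ω => M.Z ω ⬝ᵥ M.A j) + fun ω => M.E ω j := by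
    funext ω
    simp only [X, Matrix.mulVec, Pi.add_apply, dotProduct_comm]
  have hZ (u : Fin K → ℝ) := memLp_dotProduct M.memLp_Z u
  have hZE (u : Fin K → ℝ) : cov[fun ω => M.E ω j, fun ω => M.Z ω ⬝ᵥ u; P] = 0 :=
    (M.indep_Z.symm.comp (φ := fun q : (Fin p → ℝ) × ℝ => q.1 j) (ψ := fun z => z ⬝ᵥ u)
      (by fun_prop) (by fun_prop)).covariance_eq_zero (M.memLp_E.eval j) (hZ u)
  have hZε (u : Fin K → ℝ) : cov[fun ω => M.Z ω ⬝ᵥ u, M.ε; P] = 0 :=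
    (M.indep_Z.comp (φ := fun z => z ⬝ᵥ u) (ψ := Prod.snd) (by fun_prop)
      measurable_snd).covariance_eq_zero (hZ u) M.memLp_ε
  have hEε : cov[fun ω => M.E ω j, M.ε; P] = 0 :=
    (M.indep_E.comp (measurable_pi_apply j) measurable_id).covariance_eq_zero
      (M.memLp_E.eval j) M.memLp_ε
  have hcov : M.covXy j = cov[fun ω => M.X ω j, M.y; P] := by
    rw [covariance_eq_sub (M.memLp_X.eval j) M.memLp_y, M.integral_y, mul_zero, sub_zero]
    rfl
  have hy : M.y = (fun ω => M.Z ω ⬝ᵥ M.β) + M.ε := rfl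
  rw [hcov, hXj, hy, covariance_add_left (hZ _) (M.memLp_E.eval j) ((hZ _).add M.memLp_ε),
    covariance_add_right (hZ _) (hZ _) M.memLp_ε,
    covariance_add_right (M.memLp_E.eval j) (hZ _) M.memLp_ε, hZE, hZε, hEε,
    covariance_dotProduct M.memLp_Z]
  simp only [add_zero]
  rfl

theorem wNormSq_covX (x : Fin p → ℝ) :
    wNormSq M.covX x = wNormSq M.covZ (M.Aᵀ *ᵥ x) + wNormSq M.covE x := by
  rw [covX_eq, wNormSq_add, wNormSq_mul_mul_transpose]

theorem risk_eq (α : Fin p → ℝ) :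
    M.risk α = wNormSq M.covZ (M.Aᵀ *ᵥ α - M.β) + wNormSq M.covE α + M.noiseVar := by
  have hE := memLp_dotProduct M.memLp_E α
  have hZ := memLp_dotProduct M.memLp_Z (M.Aᵀ *ᵥ α - M.β)
  have hres : (fun ω => M.X ω ⬝ᵥ α - M.y ω)
      = (fun ω => M.Z ω ⬝ᵥ (M.Aᵀ *ᵥ α - M.β)) + ((fun ω => M.E ω ⬝ᵥ α) - M.ε) := by
    funext ω
    simp only [X_dotProduct, y, dotProduct_sub, Pi.add_apply, Pi.sub_apply]
    ring
  have hindepZ : IndepFun (fun ω => M.Z ω ⬝ᵥ (M.Aᵀ *ᵥ α - M.β)) ((fun ω => M.E ω ⬝ᵥ α) - M.ε) P :=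
    M.indep_Z.comp (φ := fun z => z ⬝ᵥ (M.Aᵀ *ᵥ α - M.β))
      (ψ := fun q : (Fin p → ℝ) × ℝ => q.1 ⬝ᵥ α - q.2)
      (by fun_prop) (by fun_prop)
  have hindepE : IndepFun (fun ω => M.E ω ⬝ᵥ α) M.ε P :=
    M.indep_E.comp (φ := fun e => e ⬝ᵥ α) (ψ := id) (by fun_prop) measurable_id
  have hmean : ∫ ω, M.X ω ⬝ᵥ α - M.y ω ∂P = 0 := by
    rw [integral_sub ((memLp_dotProduct M.memLp_X α).integrable one_le_two)
      (M.memLp_y.integrable one_le_two), M.integral_X_dotProduct, M.integral_y, sub_zero]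
  have hvar : M.risk α = Var[fun ω => M.X ω ⬝ᵥ α - M.y ω; P] :=
    (variance_of_integral_eq_zero
      ((memLp_dotProduct M.memLp_X α).sub M.memLp_y).aemeasurable hmean).symm
  rw [hvar, hres, hindepZ.variance_add hZ (hE.sub M.memLp_ε), variance_sub hE M.memLp_ε,
    hindepE.covariance_eq_zero hE M.memLp_ε, mul_zero, sub_zero, variance_dotProduct M.memLp_Z,
    variance_dotProduct M.memLp_E, ← add_assoc]
  rfl

theorem snr_nonneg : 0 ≤ M.snr :=
  div_nonneg (ordEig_nonneg (posSemidef_mul_mul_transpose M.A M.posSemidef_covZ) K)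
    (opNorm_nonneg M.covE)

theorem noiseVar_le_risk (α : Fin p → ℝ) : M.noiseVar ≤ M.risk α := by
  rw [risk_eq]
  linarith [wNormSq_nonneg M.posSemidef_covE α,
    wNormSq_nonneg M.posSemidef_covZ (M.Aᵀ *ᵥ α - M.β)]

variable {M}

theorem wNormSq_covX_le_of_transpose_mulVec_eq_zero {U : Matrix (Fin p) (Fin K) ℝ}
    (hU : IsTopEigenvectors M.covX U) {x : Fin p → ℝ} (hx : Uᵀ *ᵥ x = 0) :
    wNormSq M.covX x ≤ opNorm M.covE * (x ⬝ᵥ x) := by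
  refine (hU.wNormSq_le_of_transpose_mulVec_eq_zero M.posSemidef_covX.1 hx).trans ?_
  refine mul_le_mul_of_nonneg_right ?_ (dotProduct_self_nonneg x)
  refine ordEig_succ_le_of_forall_wNormSq_le M.posSemidef_covX.1 M.A (opNorm_nonneg _)
    fun z hz => ?_
  rw [wNormSq_covX, hz, wNormSq_zero, zero_add]
  exact wNormSq_le_opNorm_mul _ _

variable (hM : M.FullRank)
include hM

theorem FullRank.covX_mulVec_bestLinear :
    M.covX *ᵥ M.bestLinear = M.A *ᵥ (M.covZ *ᵥ M.β) := by
  rw [bestLinear, covXy_eq]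
  refine mulVec_pinv_mulVec_of_forall_dotProduct_eq_zero M.posSemidef_covX.1 fun z hz => ?_
  have hAz : M.Aᵀ *ᵥ z = 0 := by
    by_contra hne
    have hXz : wNormSq M.covX z = 0 := by rw [wNormSq, hz, dotProduct_zero]
    rw [wNormSq_covX] at hXz
    linarith [wNormSq_pos hM.posDef_covZ hne, wNormSq_nonneg M.posSemidef_covE z]
  rw [dotProduct_mulVec_transpose, hAz, zero_dotProduct]

theorem FullRank.risk_eq_risk_bestLinear_add (α : Fin p → ℝ) :
    M.risk α = M.risk M.bestLinear + wNormSq M.covX (α - M.bestLinear) := by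
  have hquad (α : Fin p → ℝ) : M.risk α = wNormSq M.covX α
      - 2 * (α ⬝ᵥ (M.covX *ᵥ M.bestLinear)) + wNormSq M.covZ M.β + M.noiseVar := by
    rw [risk_eq, wNormSq_sub M.posSemidef_covZ.1, wNormSq_covX, hM.covX_mulVec_bestLinear,
      dotProduct_mulVec_transpose M.A]
    ring
  rw [hquad α, hquad M.bestLinear, wNormSq_sub M.posSemidef_covX.1]
  unfold wNormSq
  ring

theorem FullRank.risk_bestLinear_le (α : Fin p → ℝ) : M.risk M.bestLinear ≤ M.risk α := by
  rw [hM.risk_eq_risk_bestLinear_add α]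
  linarith [wNormSq_nonneg M.posSemidef_covX (α - M.bestLinear)]

theorem FullRank.ordEig_signal_pos (hK : 1 ≤ K) : 0 < ordEig (M.A * M.covZ * M.Aᵀ) K :=
  ordEig_mul_mul_transpose_pos hM.mulVec_injective hM.posDef_covZ hK

theorem FullRank.ordEig_covX_pos (k : Fin K) : 0 < ordEig M.covX ((k : ℕ) + 1) := by
  have hK : 0 < ordEig M.covX K := by
    refine lt_ordEig_of_forall_lt_wNormSq M.posSemidef_covX.1 M.A (fun c hc => ?_) k.pos
    rw [zero_mul, wNormSq_covX, Matrix.mulVec_mulVec]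
    have hAc : (M.Aᵀ * M.A) *ᵥ c ≠ 0 := fun h =>
      hc (transpose_mul_self_mulVec_injective hM.mulVec_injective
        (h.trans (Matrix.mulVec_zero _).symm))
    linarith [wNormSq_pos hM.posDef_covZ hAc, wNormSq_nonneg M.posSemidef_covE (M.A *ᵥ c)]
  have hKp : K ≤ p := by
    by_contra! hpK
    exact hK.ne' (ordEig_eq_zero_of_lt _ hpK)
  exact hK.trans_le (ordEig_antitone M.posSemidef_covX.1 (Nat.le_add_left 1 k) k.isLt hKp)

theorem FullRank.risk_projection_le {U : Matrix (Fin p) (Fin K) ℝ}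
    (hU : IsTopEigenvectors M.covX U) :
    M.risk (U *ᵥ (Uᵀ *ᵥ M.bestLinear))
      ≤ M.risk M.bestLinear + opNorm M.covE * (M.bestLinear ⬝ᵥ M.bestLinear) := by
  rw [hM.risk_eq_risk_bestLinear_add]
  gcongr
  exact (wNormSq_covX_le_of_transpose_mulVec_eq_zero hU
    (hU.transpose_mulVec_projection_sub _)).trans
      (mul_le_mul_of_nonneg_left (hU.projection_sub_dotProduct_self_le _) (opNorm_nonneg _))

theorem FullRank.risk_bestLinear_sub_noiseVar_le (hK : 1 ≤ K) :
    M.risk M.bestLinear - M.noiseVar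
      ≤ (1 + M.snr⁻¹) * opNorm M.covE * (M.bestLinear ⬝ᵥ M.bestLinear) := by
  have hnormal : M.A *ᵥ (M.covZ *ᵥ (M.Aᵀ *ᵥ M.bestLinear - M.β))
      = -(M.covE *ᵥ M.bestLinear) := by
    rw [Matrix.mulVec_sub, Matrix.mulVec_sub, ← hM.covX_mulVec_bestLinear, covX_eq,
      Matrix.add_mulVec, ← Matrix.mulVec_mulVec, ← Matrix.mulVec_mulVec]
    abel
  have hsignal := ordEig_mul_wNormSq_le_mulVec_sq hM.mulVec_injective M.posSemidef_covZ
    (M.Aᵀ *ᵥ M.bestLinear - M.β)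
  rw [hnormal, neg_dotProduct_neg] at hsignal
  have hbias : wNormSq M.covZ (M.Aᵀ *ᵥ M.bestLinear - M.β)
      ≤ M.snr⁻¹ * opNorm M.covE * (M.bestLinear ⬝ᵥ M.bestLinear) := by
    rw [snr, inv_div, div_mul_eq_mul_div, div_mul_eq_mul_div, ← sq,
      le_div_iff₀' (hM.ordEig_signal_pos hK)]
    exact hsignal.trans (mulVec_sq_le_opNorm_sq_mul _ _)
  rw [risk_eq]
  linarith [wNormSq_le_opNorm_mul M.covE M.bestLinear]

theorem FullRank.risk_bestLinear_sub_noiseVar_le_snr (hK : 1 ≤ K) :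
    M.risk M.bestLinear - M.noiseVar ≤ wNormSq M.covZ M.β / M.snr := by
  obtain ⟨α, hα, hle⟩ :=
    exists_transpose_mulVec_eq_and_ordEig_mul_le hM.mulVec_injective hM.posDef_covZ M.β
  have hrisk := hM.risk_bestLinear_le α
  rw [M.risk_eq α, hα, sub_self, wNormSq_zero, zero_add] at hrisk
  have hE : opNorm M.covE * (α ⬝ᵥ α) ≤ wNormSq M.covZ M.β / M.snr := by
    rw [snr, div_div_eq_mul_div, le_div_iff₀ (hM.ordEig_signal_pos hK)]
    linarith [mul_le_mul_of_nonneg_left hle (opNorm_nonneg M.covE)]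
  linarith [wNormSq_le_opNorm_mul M.covE α]

theorem FullRank.opNorm_mul_bestLinear_sq_le (hK : 1 ≤ K) (hE : 0 < ordEig M.covE p) :
    opNorm M.covE * (M.bestLinear ⬝ᵥ M.bestLinear)
      ≤ condNumber M.covE * (wNormSq M.covZ M.β / M.snr) := by
  have hopNorm := opNorm_le_ordEig_one M.posSemidef_covE
  have hlast : ordEig M.covE p * (M.bestLinear ⬝ᵥ M.bestLinear)
      ≤ wNormSq M.covZ M.β / M.snr := by
    have hexcess := hM.risk_bestLinear_sub_noiseVar_le_snr hK
    rw [risk_eq] at hexcess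
    linarith [ordEig_last_mul_le_wNormSq M.posSemidef_covE.1 M.bestLinear,
      wNormSq_nonneg M.posSemidef_covZ (M.Aᵀ *ᵥ M.bestLinear - M.β)]
  rw [condNumber, div_mul_eq_mul_div, le_div_iff₀ hE]
  calc opNorm M.covE * (M.bestLinear ⬝ᵥ M.bestLinear) * ordEig M.covE p
      ≤ ordEig M.covE 1 * (M.bestLinear ⬝ᵥ M.bestLinear) * ordEig M.covE p := by
        gcongr
        exact dotProduct_self_nonneg _
    _ = ordEig M.covE 1 * (ordEig M.covE p * (M.bestLinear ⬝ᵥ M.bestLinear)) := by ring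
    _ ≤ ordEig M.covE 1 * (wNormSq M.covZ M.β / M.snr) :=
        mul_le_mul_of_nonneg_left hlast (ordEig_nonneg M.posSemidef_covE 1)

end FactorModel

section

/-! ### Concentration of Gaussian sums of squares -/

open scoped NNReal

theorem inv_sqrt_one_sub_le_exp {θ : ℝ} (hθ : |θ| ≤ 1 / 6) :
    (√(1 - 2 * θ))⁻¹ ≤ Real.exp (θ + 2 * θ ^ 2) := by
  obtain ⟨hlo, hhi⟩ := abs_le.1 hθ
  have habs : |2 * θ| ≤ 1 / 3 := abs_le.2 ⟨by linarith, by linarith⟩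
  have htaylor : |2 * θ| ^ 3 / (1 - |2 * θ|) ≤ 2 * θ ^ 2 := by
    have hsq : θ ^ 2 = |2 * θ| ^ 2 / 4 := by rw [sq_abs]; ring
    rw [div_le_iff₀ (by linarith), hsq]
    nlinarith [sq_nonneg |2 * θ|]
  have hlog := (Real.abs_log_sub_add_sum_range_le (habs.trans_lt (by norm_num)) 2).trans htaylor
  simp only [Finset.sum_range_succ, Finset.sum_range_zero] at hlog
  have hpos : 0 < √(1 - 2 * θ) := Real.sqrt_pos.2 (by linarith)
  rw [← Real.log_le_iff_le_exp (inv_pos.2 hpos), Real.log_inv, Real.log_sqrt (by linarith)]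
  norm_num at hlog
  linarith [(abs_le.1 hlog).1]

theorem gaussianPDFReal_zero_mul_exp_sq {v : ℝ≥0} (hv : v ≠ 0) (t x : ℝ) :
    gaussianPDFReal 0 v x * Real.exp (t * x ^ 2)
      = (√(2 * Real.pi * v))⁻¹ * Real.exp (-((1 - 2 * (v * t)) / (2 * v)) * x ^ 2) := by
  rw [gaussianPDFReal, mul_assoc, ← Real.exp_add]
  congr 2
  have hv' : (v : ℝ) ≠ 0 := NNReal.coe_ne_zero.2 hv
  field_simp
  ring

theorem mgf_sq_gaussianReal (v : ℝ≥0) {t : ℝ} (ht : 2 * (v * t) < 1) :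
    mgf (fun x => x ^ 2) (gaussianReal 0 v) t = (√(1 - 2 * (v * t)))⁻¹ := by
  rcases eq_or_ne v 0 with rfl | hv
  · simp [mgf]
  have hv' : (v : ℝ) ≠ 0 := NNReal.coe_ne_zero.2 hv
  have : 1 - 2 * (v * t) ≠ 0 := by linarith
  rw [mgf, integral_gaussianReal_eq_integral_smul hv]
  simp only [smul_eq_mul, gaussianPDFReal_zero_mul_exp_sq hv]
  rw [integral_const_mul, integral_gaussian, ← Real.sqrt_inv, ← Real.sqrt_inv,
    ← Real.sqrt_mul (by positivity)]
  congr 1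
  field_simp

variable {Ω ι : Type*} [MeasurableSpace Ω] {μ : Measure Ω} [Fintype ι] {f : ι → Ω → ℝ} {v : ℝ≥0}

theorem mgf_sum_sq_of_iIndepFun (hf : iIndepFun f μ) (hlaw : ∀ i, HasLaw (f i) (gaussianReal 0 v) μ)
    {t : ℝ} (ht : 2 * (v * t) < 1) :
    mgf (fun ω => ∑ i, f i ω ^ 2) μ t = (√(1 - 2 * (v * t)))⁻¹ ^ Fintype.card ι := by
  have hfactor (i : ι) : mgf (fun ω => f i ω ^ 2) μ t = (√(1 - 2 * (v * t)))⁻¹ := by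
    rw [← mgf_sq_gaussianReal v ht, ← (hlaw i).map_eq,
      mgf_map (hlaw i).aemeasurable (by fun_prop)]
    rfl
  have hindep : iIndepFun (fun i ω => f i ω ^ 2) μ :=
    hf.comp (fun _ x => x ^ 2) fun _ => by fun_prop
  have hsum : (fun ω => ∑ i, f i ω ^ 2) = ∑ i, fun ω => f i ω ^ 2 := by
    funext ω
    rw [Finset.sum_apply]
  rw [hsum, hindep.mgf_sum₀ fun i => (hlaw i).aemeasurable.pow_const 2]
  exact (Finset.prod_congr rfl fun i _ => hfactor i).trans (Finset.prod_const _)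

theorem integrable_exp_mul_sum_sq (hf : iIndepFun f μ)
    (hlaw : ∀ i, HasLaw (f i) (gaussianReal 0 v) μ) {t : ℝ} (ht : 2 * (v * t) < 1) :
    Integrable (fun ω => Real.exp (t * ∑ i, f i ω ^ 2)) μ := by
  refine .of_integral_ne_zero (ne_of_eq_of_ne (mgf_sum_sq_of_iIndepFun hf hlaw ht) ?_)
  exact pow_ne_zero _ (inv_ne_zero (Real.sqrt_pos.2 (by linarith)).ne')

theorem mgf_sum_sq_le_exp (hf : iIndepFun f μ) (hlaw : ∀ i, HasLaw (f i) (gaussianReal 0 v) μ)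
    {t : ℝ} (ht : |v * t| ≤ 1 / 6) :
    mgf (fun ω => ∑ i, f i ω ^ 2) μ t
      ≤ Real.exp (Fintype.card ι * (v * t + 2 * (v * t) ^ 2)) := by
  rw [mgf_sum_sq_of_iIndepFun hf hlaw (by linarith [(abs_le.1 ht).2]), Real.exp_nat_mul]
  exact pow_le_pow_left₀ (by positivity) (inv_sqrt_one_sub_le_exp ht) _

theorem measureReal_le_sum_sq_le (hf : iIndepFun f μ)
    (hlaw : ∀ i, HasLaw (f i) (gaussianReal 0 v) μ) (hv : v ≠ 0) {u : ℝ} (hu0 : 0 ≤ u)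
    (hu1 : u ≤ 2 / 3) :
    μ.real {ω | Fintype.card ι * v * (1 + u) ≤ ∑ i, f i ω ^ 2}
      ≤ Real.exp (-(Fintype.card ι * u ^ 2 / 8)) := by
  have : IsProbabilityMeasure μ := hf.isProbabilityMeasure
  have hvt : v * (u / (4 * v)) = u / 4 := by
    have : (v : ℝ) ≠ 0 := NNReal.coe_ne_zero.2 hv
    field_simp
  have hmgf := mgf_sum_sq_le_exp hf hlaw (t := u / (4 * v))
    (by rw [hvt, abs_of_nonneg (by positivity)]; linarith)
  refine (measure_ge_le_exp_mul_mgf _ (by positivity)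
    (integrable_exp_mul_sum_sq hf hlaw (by rw [hvt]; linarith))).trans
    ((mul_le_mul_of_nonneg_left hmgf (Real.exp_pos _).le).trans_eq ?_)
  rw [← Real.exp_add, hvt]
  congr 1
  linear_combination (-(Fintype.card ι * (1 + u))) * hvt

theorem measureReal_sum_sq_le_le (hf : iIndepFun f μ)
    (hlaw : ∀ i, HasLaw (f i) (gaussianReal 0 v) μ) (hv : v ≠ 0) {u : ℝ} (hu0 : 0 ≤ u)
    (hu1 : u ≤ 2 / 3) :
    μ.real {ω | ∑ i, f i ω ^ 2 ≤ Fintype.card ι * v * (1 - u)}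
      ≤ Real.exp (-(Fintype.card ι * u ^ 2 / 8)) := by
  have : IsProbabilityMeasure μ := hf.isProbabilityMeasure
  have hvt : v * (-(u / (4 * v))) = -(u / 4) := by
    have : (v : ℝ) ≠ 0 := NNReal.coe_ne_zero.2 hv
    field_simp
  have hmgf := mgf_sum_sq_le_exp hf hlaw (t := -(u / (4 * v)))
    (by rw [hvt, abs_neg, abs_of_nonneg (by positivity)]; linarith)
  refine (measure_le_le_exp_mul_mgf _ (neg_nonpos.2 (by positivity))
    (integrable_exp_mul_sum_sq hf hlaw (by rw [hvt]; linarith))).trans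
    ((mul_le_mul_of_nonneg_left hmgf (Real.exp_pos _).le).trans_eq ?_)
  rw [← Real.exp_add, hvt]
  congr 1
  linear_combination (-(Fintype.card ι * (1 - u))) * hvt

theorem sum_sq_ae_eq_zero (hlaw : ∀ i, HasLaw (f i) (gaussianReal 0 0) μ) :
    ∀ᵐ ω ∂μ, ∑ i, f i ω ^ 2 = 0 := by
  have hzero (i : ι) : f i =ᵐ[μ] fun _ => 0 :=
    (gaussianReal_zero_var (0 : ℝ) ▸ hlaw i).ae_eq_of_dirac
  filter_upwards [ae_all_iff.2 hzero] with ω hω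
  simp only [hω, ne_eq, OfNat.ofNat_ne_zero, not_false_eq_true, zero_pow, Finset.sum_const_zero]

theorem measureReal_lt_abs_sum_sq_sub_le (hf : iIndepFun f μ)
    (hlaw : ∀ i, HasLaw (f i) (gaussianReal 0 v) μ) {u : ℝ} (hu0 : 0 ≤ u) (hu1 : u ≤ 2 / 3) :
    μ.real {ω | Fintype.card ι * v * u < |∑ i, f i ω ^ 2 - Fintype.card ι * v|}
      ≤ 2 * Real.exp (-(Fintype.card ι * u ^ 2 / 8)) := by
  have : IsProbabilityMeasure μ := hf.isProbabilityMeasure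
  rcases eq_or_ne v 0 with rfl | hv
  · refine Eq.trans_le ((measureReal_eq_zero_iff).2 (measure_eq_zero_iff_ae_notMem.2 ?_))
      (by positivity)
    filter_upwards [sum_sq_ae_eq_zero hlaw] with ω hω
    simp [hω]
  have hsubset : {ω | Fintype.card ι * v * u < |∑ i, f i ω ^ 2 - Fintype.card ι * v|}
      ⊆ {ω | Fintype.card ι * v * (1 + u) ≤ ∑ i, f i ω ^ 2}
        ∪ {ω | ∑ i, f i ω ^ 2 ≤ Fintype.card ι * v * (1 - u)} := by
    intro ω hω
    simp only [Set.mem_union, Set.mem_ofPred_eq] at hω ⊢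
    rcases lt_abs.1 hω with h | h
    · exact .inl (by linarith)
    · exact .inr (by linarith)
  linarith [(measureReal_mono hsubset (measure_ne_top μ _)).trans (measureReal_union_le _ _),
    measureReal_le_sum_sq_le hf hlaw hv hu0 hu1, measureReal_sum_sq_le_le hf hlaw hv hu0 hu1]

end

section

/-! ### A grid for smallest singular values -/

/-- The grid `{z / m : z ∈ {-m, …, m}^K}` in the cube `[-1, 1]^K`, which serves as a net for the
unit sphere of `ℝ^K`. -/
noncomputable def cubeGrid (K m : ℕ) : Finset (Fin K → ℝ) :=
  (Fintype.piFinset fun _ : Fin K => Finset.Icc (-(m : ℤ)) m).image fun z k => (z k : ℝ) / m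

theorem card_cubeGrid_le (K m : ℕ) : (cubeGrid K m).card ≤ (2 * m + 1) ^ K := by
  refine Finset.card_image_le.trans_eq ?_
  rw [Fintype.card_piFinset_const, Int.card_Icc]
  congr 1
  omega

variable {n K m : ℕ}

theorem single_mem_cubeGrid (hm : 1 ≤ m) (k : Fin K) :
    (Pi.single k 1 : Fin K → ℝ) ∈ cubeGrid K m := by
  refine Finset.mem_image.2 ⟨Pi.single k (m : ℤ), Fintype.mem_piFinset.2 fun j => ?_, ?_⟩
  · rcases eq_or_ne j k with rfl | hj
    · simp
    · simp [hj]
  · funext j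
    rcases eq_or_ne j k with rfl | hj
    · simp [show (m : ℝ) ≠ 0 by positivity]
    · simp [hj]

theorem exists_mem_cubeGrid_abs_sub_le (hm : 1 ≤ m) {x : Fin K → ℝ} (hx : ∀ k, |x k| ≤ 1) :
    ∃ v ∈ cubeGrid K m, ∀ k, |x k - v k| ≤ 1 / m := by
  have hm' : (0 : ℝ) < m := by positivity
  refine ⟨fun k => (⌊m * x k⌋ : ℝ) / m,
    Finset.mem_image.2 ⟨fun k => ⌊m * x k⌋, Fintype.mem_piFinset.2 fun k => ?_, rfl⟩, fun k => ?_⟩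
  · obtain ⟨hlo, hhi⟩ := abs_le.1 (hx k)
    rw [Finset.mem_Icc, Int.le_floor, ← Int.lt_add_one_iff, Int.floor_lt]
    push_cast
    constructor <;> nlinarith
  · have hfract : x k - (⌊m * x k⌋ : ℝ) / m = Int.fract (m * x k) / m := by
      rw [Int.fract]
      field_simp
    rw [hfract, abs_of_nonneg (div_nonneg (Int.fract_nonneg _) hm'.le)]
    gcongr
    exact (Int.fract_lt_one _).le

theorem half_dotProduct_self_le {ι : Type*} [Fintype ι] (a b : ι → ℝ) :
    1 / 2 * (a ⬝ᵥ a) ≤ (a + b) ⬝ᵥ (a + b) + b ⬝ᵥ b := by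
  have hsq := dotProduct_self_nonneg (a + (2 : ℝ) • b)
  simp only [add_dotProduct, dotProduct_add, smul_dotProduct, dotProduct_smul, smul_eq_mul,
    dotProduct_comm b a] at hsq ⊢
  linarith

theorem mulVec_sq_le_sum_col_sq_mul (W : Matrix (Fin n) (Fin K) ℝ) (x : Fin K → ℝ) :
    (W *ᵥ x) ⬝ᵥ (W *ᵥ x) ≤ (∑ k, (W *ᵥ Pi.single k 1) ⬝ᵥ (W *ᵥ Pi.single k 1)) * (x ⬝ᵥ x) := by
  simp only [dotProduct_self_eq_sum_sq, Matrix.mulVec_single_one, Matrix.col_apply]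
  rw [Finset.sum_comm, Finset.sum_mul]
  exact Finset.sum_le_sum fun i _ => Finset.sum_mul_sq_le_sq_mul_sq Finset.univ (W i) x

theorem abs_apply_le_one {x : Fin K → ℝ} (hx : x ⬝ᵥ x = 1) (k : Fin K) : |x k| ≤ 1 := by
  rw [← sq_le_one_iff_abs_le_one, ← hx, dotProduct_self_eq_sum_sq]
  exact Finset.single_le_sum (f := fun k => x k ^ 2) (fun i _ => sq_nonneg _) (Finset.mem_univ k)

theorem dotProduct_self_le_card_mul_sq {x : Fin K → ℝ} {r : ℝ} (hx : ∀ k, |x k| ≤ r) :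
    x ⬝ᵥ x ≤ K * r ^ 2 := by
  rw [dotProduct_self_eq_sum_sq]
  refine (Finset.sum_le_card_nsmul _ _ (r ^ 2) fun k _ => ?_).trans_eq (by simp)
  rw [← sq_abs]
  exact pow_le_pow_left₀ (abs_nonneg _) (hx k) 2

theorem le_mulVec_sq_of_forall_mem_cubeGrid_of_unit (hK : 1 ≤ K) (W : Matrix (Fin n) (Fin K) ℝ)
    {c : ℝ} (hc : 0 ≤ c) (hW : ∀ v ∈ cubeGrid K (16 * K),
      |(W *ᵥ v) ⬝ᵥ (W *ᵥ v) - c * (v ⬝ᵥ v)| ≤ c * (v ⬝ᵥ v) * (1 / 2)) {x : Fin K → ℝ}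
    (hx : x ⬝ᵥ x = 1) : c / 10 ≤ (W *ᵥ x) ⬝ᵥ (W *ᵥ x) := by
  have hK' : (1 : ℝ) ≤ K := by exact_mod_cast hK
  obtain ⟨v, hv, hnear⟩ :=
    exists_mem_cubeGrid_abs_sub_le (m := 16 * K) (by omega) (abs_apply_le_one hx)
  have hd : (x - v) ⬝ᵥ (x - v) ≤ 1 / (256 * K) :=
    (dotProduct_self_le_card_mul_sq hnear).trans_eq (by push_cast; field_simp; norm_num)
  have hd' : (x - v) ⬝ᵥ (x - v) ≤ 1 / 256 :=
    hd.trans (one_div_le_one_div_of_le (by norm_num) (by linarith))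
  have hcols : ∑ k, (W *ᵥ Pi.single k 1) ⬝ᵥ (W *ᵥ Pi.single k 1) ≤ K * (c * (3 / 2)) := by
    refine (Finset.sum_le_card_nsmul _ _ (c * (3 / 2)) fun k _ => ?_).trans_eq (by simp)
    have hk := (abs_le.1 (hW _ (single_mem_cubeGrid (by omega) k))).2
    simp only [single_dotProduct, Pi.single_eq_same, mul_one] at hk
    linarith
  have hWd : (W *ᵥ (x - v)) ⬝ᵥ (W *ᵥ (x - v)) ≤ c * (3 / 512) :=
    calc (W *ᵥ (x - v)) ⬝ᵥ (W *ᵥ (x - v))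
        ≤ K * (c * (3 / 2)) * (1 / (256 * K)) := (mulVec_sq_le_sum_col_sq_mul W _).trans
          (mul_le_mul hcols hd (dotProduct_self_nonneg _) (by positivity))
      _ = c * (3 / 512) := by field_simp; ring
  have hvv : 1 / 2 - 1 / 256 ≤ v ⬝ᵥ v := by
    have h := half_dotProduct_self_le x (v - x)
    rw [add_sub_cancel, hx, ← neg_sub x v, neg_dotProduct_neg] at h
    linarith
  have hWv := half_dotProduct_self_le (W *ᵥ v) (W *ᵥ (x - v))
  rw [← Matrix.mulVec_add, add_sub_cancel] at hWv
  linarith [(abs_le.1 (hW v hv)).1, mul_le_mul_of_nonneg_left hvv hc]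

theorem le_mulVec_sq_of_forall_mem_cubeGrid (hK : 1 ≤ K) (W : Matrix (Fin n) (Fin K) ℝ)
    {c : ℝ} (hc : 0 ≤ c) (hW : ∀ v ∈ cubeGrid K (16 * K),
      |(W *ᵥ v) ⬝ᵥ (W *ᵥ v) - c * (v ⬝ᵥ v)| ≤ c * (v ⬝ᵥ v) * (1 / 2)) (x : Fin K → ℝ) :
    c / 10 * (x ⬝ᵥ x) ≤ (W *ᵥ x) ⬝ᵥ (W *ᵥ x) := by
  rcases eq_or_ne x 0 with rfl | hx
  · simp
  have hxx := dotProduct_self_pos hx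
  have hinv : (√(x ⬝ᵥ x))⁻¹ * (√(x ⬝ᵥ x))⁻¹ = (x ⬝ᵥ x)⁻¹ := by
    rw [← mul_inv, Real.mul_self_sqrt hxx.le]
  have hunit := le_mulVec_sq_of_forall_mem_cubeGrid_of_unit hK W hc hW
    (x := (√(x ⬝ᵥ x))⁻¹ • x) (by
      rw [smul_dotProduct, dotProduct_smul, smul_eq_mul, smul_eq_mul, ← mul_assoc, hinv,
        inv_mul_cancel₀ hxx.ne'])
  rwa [Matrix.mulVec_smul, smul_dotProduct, dotProduct_smul, smul_eq_mul, smul_eq_mul,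
    ← mul_assoc, hinv, ← div_eq_inv_mul, le_div_iff₀ hxx] at hunit

end

section

/-! ### The estimator given the sample -/

variable {n p K : ℕ}

/-- The matrix `U Λ^{-1/2}`, where `Λ` is the diagonal matrix of the `K` largest eigenvalues of
`Q`: a random vector with covariance matrix `Q` has uncorrelated components of unit variance along
its columns. -/
noncomputable def whitening (Q : Matrix (Fin p) (Fin p) ℝ) (U : Matrix (Fin p) (Fin K) ℝ) :
    Matrix (Fin p) (Fin K) ℝ :=
  U * Matrix.diagonal fun k : Fin K => (√(ordEig Q (k + 1)))⁻¹

theorem whitening_mulVec (Q : Matrix (Fin p) (Fin p) ℝ) (U : Matrix (Fin p) (Fin K) ℝ)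
    (v : Fin K → ℝ) :
    whitening Q U *ᵥ v = U *ᵥ fun k : Fin K => v k / √(ordEig Q (k + 1)) := by
  rw [whitening, ← Matrix.mulVec_mulVec]
  congr 1
  funext k
  rw [Matrix.mulVec_diagonal, div_eq_inv_mul]

theorem whitening_mulVec_sqrt_mul {Q : Matrix (Fin p) (Fin p) ℝ}
    (hQ : ∀ k : Fin K, 0 < ordEig Q (k + 1)) (U : Matrix (Fin p) (Fin K) ℝ) (c : Fin K → ℝ) :
    whitening Q U *ᵥ (fun k : Fin K => √(ordEig Q (k + 1)) * c k) = U *ᵥ c := by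
  rw [whitening_mulVec]
  congr 1
  funext k
  exact mul_div_cancel_left₀ _ (Real.sqrt_pos.2 (hQ k)).ne'

theorem IsTopEigenvectors.wNormSq_whitening_mulVec {Q : Matrix (Fin p) (Fin p) ℝ}
    {U : Matrix (Fin p) (Fin K) ℝ} (hU : IsTopEigenvectors Q U)
    (hQ : ∀ k : Fin K, 0 < ordEig Q (k + 1)) (v : Fin K → ℝ) :
    wNormSq Q (whitening Q U *ᵥ v) = v ⬝ᵥ v := by
  rw [whitening_mulVec, hU.wNormSq_mulVec, dotProduct_self_eq_sum_sq]
  refine Finset.sum_congr rfl fun k _ => ?_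
  rw [div_pow, Real.sq_sqrt (hQ k).le, mul_div_cancel₀ _ (hQ k).ne']

theorem transpose_mulVec_whitening_pcr_error (Q : Matrix (Fin p) (Fin p) ℝ)
    (X : Matrix (Fin n) (Fin p) ℝ) (U : Matrix (Fin p) (Fin K) ℝ) (y : Fin n → ℝ) (γ : Fin K → ℝ) :
    (X * whitening Q U)ᵀ *ᵥ ((X * U) *ᵥ (pinv (X * U) *ᵥ y - γ))
      = (X * whitening Q U)ᵀ *ᵥ (y - X *ᵥ (U *ᵥ γ)) := by
  have hnormal : (X * U)ᵀ *ᵥ ((X * U) *ᵥ (pinv (X * U) *ᵥ y - γ))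
      = (X * U)ᵀ *ᵥ (y - (X * U) *ᵥ γ) := by
    rw [Matrix.mulVec_sub, Matrix.mulVec_sub, transpose_mulVec_mulVec_pinv, Matrix.mulVec_sub]
  rw [whitening, ← Matrix.mul_assoc, Matrix.transpose_mul, Matrix.mulVec_mulVec γ X U,
    ← Matrix.mulVec_mulVec _ _ (X * U)ᵀ, hnormal, Matrix.mulVec_mulVec]

theorem sq_mul_dotProduct_self_le_of_transpose_mulVec_eq {W : Matrix (Fin n) (Fin K) ℝ} {c : ℝ}
    (hc : 0 ≤ c) (hW : ∀ v, c * (v ⬝ᵥ v) ≤ (W *ᵥ v) ⬝ᵥ (W *ᵥ v)) {g : Fin K → ℝ} {η : Fin n → ℝ}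
    (hg : Wᵀ *ᵥ (W *ᵥ g) = Wᵀ *ᵥ η) :
    c ^ 2 * (g ⬝ᵥ g) ≤ (Wᵀ *ᵥ η) ⬝ᵥ (Wᵀ *ᵥ η) := by
  have hlow : c * (g ⬝ᵥ g) ≤ (Wᵀ *ᵥ η) ⬝ᵥ g := by
    rw [← hg, ← dotProduct_mulVec_transpose]
    exact hW g
  have hsq := dotProduct_self_nonneg (Wᵀ *ᵥ η - c • g)
  simp only [sub_dotProduct, dotProduct_sub, smul_dotProduct, dotProduct_smul, smul_eq_mul,
    dotProduct_comm g] at hsq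
  linarith [mul_le_mul_of_nonneg_left hlow hc]

theorem transpose_mulVec_sq_le {W : Matrix (Fin n) (Fin K) ℝ} {η : Fin n → ℝ} {b : ℝ}
    (h : ∀ k, (η ⬝ᵥ W.col k) ^ 2 ≤ b) : (Wᵀ *ᵥ η) ⬝ᵥ (Wᵀ *ᵥ η) ≤ K * b := by
  rw [dotProduct_self_eq_sum_sq]
  refine (Finset.sum_le_card_nsmul _ _ b fun k _ => ?_).trans_eq (by simp)
  exact (congrArg (· ^ 2) (dotProduct_comm _ η)).trans_le (h k)

theorem sq_dotProduct_le_of_abs_sub_le {η w : Fin n → ℝ} {N τ u : ℝ}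
    (hadd : |(η + τ • w) ⬝ᵥ (η + τ • w) - N * (2 * τ ^ 2)| ≤ N * (2 * τ ^ 2) * u)
    (hsub : |(η - τ • w) ⬝ᵥ (η - τ • w) - N * (2 * τ ^ 2)| ≤ N * (2 * τ ^ 2) * u) :
    (η ⬝ᵥ w) ^ 2 ≤ N ^ 2 * τ ^ 2 * u ^ 2 := by
  rcases eq_or_ne τ 0 with rfl | hτ
  · have hη : η = 0 := dotProduct_self_eq_zero.1 (by simpa using hadd)
    simp [hη]
  have hpolar : (η + τ • w) ⬝ᵥ (η + τ • w) - (η - τ • w) ⬝ᵥ (η - τ • w) = 4 * τ * (η ⬝ᵥ w) := by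
    simp only [add_dotProduct, dotProduct_add, sub_dotProduct, dotProduct_sub, smul_dotProduct,
      dotProduct_smul, smul_eq_mul, dotProduct_comm w η]
    ring
  have habs : |4 * τ * (η ⬝ᵥ w)| ≤ 4 * N * τ ^ 2 * u := by
    rw [← hpolar, abs_le]
    constructor <;> linarith [(abs_le.1 hadd).1, (abs_le.1 hadd).2, (abs_le.1 hsub).1,
      (abs_le.1 hsub).2]
  refine le_of_mul_le_mul_left ?_ (show 0 < 16 * τ ^ 2 by positivity)
  calc 16 * τ ^ 2 * (η ⬝ᵥ w) ^ 2
      = |4 * τ * (η ⬝ᵥ w)| ^ 2 := by rw [sq_abs]; ring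
    _ ≤ (4 * N * τ ^ 2 * u) ^ 2 := pow_le_pow_left₀ (abs_nonneg _) habs 2
    _ = 16 * τ ^ 2 * (N ^ 2 * τ ^ 2 * u ^ 2) := by ring

namespace FactorModel

variable {Ω : Type*} [MeasurableSpace Ω] {P : Measure Ω} [IsProbabilityMeasure P]
  {M : FactorModel P p K} {U : Matrix (Fin p) (Fin K) ℝ}

theorem FullRank.risk_projection_add (hM : M.FullRank) (hU : IsTopEigenvectors M.covX U)
    (c : Fin K → ℝ) :
    M.risk (U *ᵥ (Uᵀ *ᵥ M.bestLinear) + U *ᵥ c)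
      = M.risk (U *ᵥ (Uᵀ *ᵥ M.bestLinear)) + wNormSq M.covX (U *ᵥ c) := by
  have horth : (U *ᵥ (Uᵀ *ᵥ M.bestLinear) - M.bestLinear) ⬝ᵥ (M.covX *ᵥ (U *ᵥ c)) = 0 := by
    rw [hU.mulVec_mulVec, dotProduct_mulVec_transpose, hU.transpose_mulVec_projection_sub,
      zero_dotProduct]
  have hsub := wNormSq_sub M.posSemidef_covX.1
    (U *ᵥ (Uᵀ *ᵥ M.bestLinear) + U *ᵥ c - M.bestLinear) (U *ᵥ c)
  rw [add_sub_right_comm, add_sub_cancel_right, add_dotProduct, horth, ← wNormSq] at hsub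
  rw [hM.risk_eq_risk_bestLinear_add, hM.risk_eq_risk_bestLinear_add (U *ᵥ (Uᵀ *ᵥ _)),
    add_sub_right_comm]
  linarith

theorem FullRank.risk_projection_add_whitening (hM : M.FullRank)
    (hU : IsTopEigenvectors M.covX U) (v : Fin K → ℝ) :
    M.risk (U *ᵥ (Uᵀ *ᵥ M.bestLinear) + whitening M.covX U *ᵥ v)
      = M.risk (U *ᵥ (Uᵀ *ᵥ M.bestLinear)) + v ⬝ᵥ v := by
  rw [← hU.wNormSq_whitening_mulVec hM.ordEig_covX_pos, whitening_mulVec,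
    hM.risk_projection_add hU]

theorem FullRank.risk_pcrEstimator_le (hM : M.FullRank) (hU : IsTopEigenvectors M.covX U)
    (hn : 0 < n) (X : Matrix (Fin n) (Fin p) ℝ) (y : Fin n → ℝ) {b : ℝ}
    (hX : ∀ v, n / 10 * (v ⬝ᵥ v)
      ≤ ((X * whitening M.covX U) *ᵥ v) ⬝ᵥ ((X * whitening M.covX U) *ᵥ v))
    (hη : ∀ k, ((y - X *ᵥ (U *ᵥ (Uᵀ *ᵥ M.bestLinear))) ⬝ᵥ (X * whitening M.covX U).col k) ^ 2
      ≤ n ^ 2 * M.risk (U *ᵥ (Uᵀ *ᵥ M.bestLinear)) * b) :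
    M.risk (pcrEstimator U X y)
      ≤ M.risk (U *ᵥ (Uᵀ *ᵥ M.bestLinear)) * (1 + 100 * K * b) := by
  set γ := Uᵀ *ᵥ M.bestLinear
  set W := X * whitening M.covX U with hW
  set η := y - X *ᵥ (U *ᵥ γ)
  set g : Fin K → ℝ := fun k => √(ordEig M.covX (k + 1)) * (pinv (X * U) *ᵥ y - γ) k
  have hg : whitening M.covX U *ᵥ g = U *ᵥ (pinv (X * U) *ᵥ y - γ) :=
    whitening_mulVec_sqrt_mul hM.ordEig_covX_pos U _
  have hnormal : Wᵀ *ᵥ (W *ᵥ g) = Wᵀ *ᵥ η := by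
    rw [← transpose_mulVec_whitening_pcr_error, hW, ← Matrix.mulVec_mulVec g, hg,
      Matrix.mulVec_mulVec _ X U]
  have herror : M.risk (pcrEstimator U X y) = M.risk (U *ᵥ γ) + g ⬝ᵥ g := by
    rw [← hM.risk_projection_add_whitening hU, hg, ← Matrix.mulVec_add, add_sub_cancel]
    rfl
  have hgg : g ⬝ᵥ g ≤ M.risk (U *ᵥ γ) * (100 * K * b) := by
    have h := (sq_mul_dotProduct_self_le_of_transpose_mulVec_eq (by positivity) hX hnormal).trans
      (transpose_mulVec_sq_le hη)
    refine le_of_mul_le_mul_left (h.trans_eq ?_) (show (0 : ℝ) < (n / 10) ^ 2 by positivity)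
    ring
  rw [herror]
  linarith

end FactorModel

end

section

/-! ### The sample -/

variable {p K n : ℕ}

theorem half_le_log {x : ℝ} (hx : 2 ≤ x) : 1 / 2 ≤ Real.log x := by
  linarith [Real.log_two_gt_d9, Real.log_le_log two_pos hx]

theorem card_cubeGrid_mul_exp_le (hK : 1 ≤ K) (hn : 2 ≤ n) (h : 128 * K * Real.log n < n) :
    (cubeGrid K (16 * K)).card * (2 * Real.exp (-(n * (1 / 2) ^ 2 / 8))) ≤ 2 / (n : ℝ) := by
  have hn' : (2 : ℝ) ≤ n := by exact_mod_cast hn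
  have hK' : (1 : ℝ) ≤ K := by exact_mod_cast hK
  have hlog : 1 / 2 ≤ Real.log n := half_le_log hn'
  have hKn : 2 * (16 * (K : ℝ)) + 1 ≤ n := by nlinarith
  have hcard : ((cubeGrid K (16 * K)).card : ℝ) ≤ Real.exp (K * Real.log n) :=
    calc ((cubeGrid K (16 * K)).card : ℝ)
        ≤ (2 * (16 * K) + 1) ^ K := by exact_mod_cast card_cubeGrid_le K (16 * K)
      _ ≤ (n : ℝ) ^ K := pow_le_pow_left₀ (by positivity) hKn K
      _ = Real.exp (K * Real.log n) := by rw [Real.exp_nat_mul, Real.exp_log (by linarith)]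
  calc (cubeGrid K (16 * K)).card * (2 * Real.exp (-(n * (1 / 2) ^ 2 / 8)))
      ≤ Real.exp (K * Real.log n) * (2 * Real.exp (-(n * (1 / 2) ^ 2 / 8))) := by gcongr
    _ = 2 * Real.exp (K * Real.log n + -(n * (1 / 2) ^ 2 / 8)) := by rw [Real.exp_add]; ring
    _ ≤ 2 * Real.exp (-Real.log n) := by gcongr; nlinarith
    _ = 2 / n := by rw [Real.exp_neg, Real.exp_log (by linarith)]; rfl

theorem exp_neg_mul_log_div {x : ℝ} (hx : 0 < x) (a : ℕ) :
    Real.exp (-(x * (8 * a * Real.log x / x) / 8)) = 1 / x ^ a := by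
  rw [show -(x * (8 * a * Real.log x / x) / 8) = -Real.log (x ^ a) by
    rw [Real.log_pow]; field_simp, Real.exp_neg, Real.exp_log (by positivity), one_div]

namespace FactorModel

variable {Ω : Type*} [MeasurableSpace Ω] {P : Measure Ω} (M : FactorModel P p K)

/-- The data matrix `𝐗` of a sample, as a random matrix. -/
def sampleX {Ω' : Type*} (Zs : Fin n → Ω' → Fin K → ℝ) (Es : Fin n → Ω' → Fin p → ℝ) (ω : Ω') :
    Matrix (Fin n) (Fin p) ℝ :=
  M.dataX (fun i => Zs i ω) fun i => Es i ω

/-- The response vector `𝐲` of a sample, as a random vector. -/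
def sampleY {Ω' : Type*} (Zs : Fin n → Ω' → Fin K → ℝ) (εs : Fin n → Ω' → ℝ) (ω : Ω') :
    Fin n → ℝ :=
  M.dataY (fun i => Zs i ω) fun i => εs i ω

variable [IsProbabilityMeasure P] {M}

theorem hasLaw_X_dotProduct_sub (hG : HasGaussianLaw (fun ω => (M.X ω, M.y ω)) P)
    (θ : Fin p → ℝ) (b : ℝ) :
    HasLaw (fun ω => M.X ω ⬝ᵥ θ - b * M.y ω)
      (gaussianReal 0 (∫ ω, (M.X ω ⬝ᵥ θ - b * M.y ω) ^ 2 ∂P).toNNReal) P := by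
  let L : ((Fin p → ℝ) × ℝ) →L[ℝ] ℝ := LinearMap.toContinuousLinearMap
    ((dotProductBilin ℝ ℝ).flip θ ∘ₗ LinearMap.fst ℝ _ _ - b • LinearMap.snd ℝ _ _)
  have hL : HasGaussianLaw (fun ω => M.X ω ⬝ᵥ θ - b * M.y ω) P := hG.map_fun L
  have hmean : ∫ ω, (M.X ω ⬝ᵥ θ - b * M.y ω) ∂P = 0 := by
    rw [integral_sub ((memLp_dotProduct M.memLp_X θ).integrable one_le_two)
      ((M.memLp_y.integrable one_le_two).const_mul b), integral_const_mul, integral_X_dotProduct,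
      integral_y, mul_zero, sub_zero]
  refine ⟨hL.aemeasurable, ?_⟩
  rw [hL.map_eq_gaussianReal, hmean, variance_of_integral_eq_zero hL.aemeasurable hmean]

theorem integral_X_dotProduct_sq (θ : Fin p → ℝ) :
    ∫ ω, (M.X ω ⬝ᵥ θ) ^ 2 ∂P = wNormSq M.covX θ := by
  rw [covX, ← variance_dotProduct M.memLp_X, variance_of_integral_eq_zero
    (memLp_dotProduct M.memLp_X θ).aemeasurable (M.integral_X_dotProduct θ)]

variable {Ω' : Type*} [MeasurableSpace Ω'] {μ : Measure Ω'} {Zs : Fin n → Ω' → Fin K → ℝ}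
  {Es : Fin n → Ω' → Fin p → ℝ} {εs : Fin n → Ω' → ℝ} {u : ℝ}

theorem IsSample.measureReal_lt_abs_sum_sq_sub_le (hS : M.IsSample μ Zs Es εs)
    (hG : HasGaussianLaw (fun ω => (M.X ω, M.y ω)) P) (θ : Fin p → ℝ) (b : ℝ) (hu0 : 0 ≤ u)
    (hu1 : u ≤ 2 / 3) :
    μ.real {ω | n * (∫ ω, (M.X ω ⬝ᵥ θ - b * M.y ω) ^ 2 ∂P) * u <
      |∑ i, ((M.sampleX Zs Es ω *ᵥ θ) i - b * M.sampleY Zs εs ω i) ^ 2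
        - n * ∫ ω, (M.X ω ⬝ᵥ θ - b * M.y ω) ^ 2 ∂P|}
      ≤ 2 * Real.exp (-(n * u ^ 2 / 8)) := by
  let φ : (Fin K → ℝ) × (Fin p → ℝ) × ℝ → ℝ :=
    fun q => (M.A *ᵥ q.1 + q.2.1) ⬝ᵥ θ - b * (q.1 ⬝ᵥ M.β + q.2.2)
  have hφ : Measurable φ := by
    simp only [φ, dotProduct, Matrix.mulVec, Pi.add_apply]
    fun_prop
  have hindep : iIndepFun (fun i ω => φ (Zs i ω, Es i ω, εs i ω)) μ :=
    hS.indep.comp (fun _ => φ) fun _ => hφ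
  have hlaw (i : Fin n) :=
    ((hS.identDistrib i).comp hφ).symm.hasLaw (hasLaw_X_dotProduct_sub hG θ b)
  have h := _root_.measureReal_lt_abs_sum_sq_sub_le hindep hlaw hu0 hu1
  rwa [Fintype.card_fin, Real.coe_toNNReal _ (integral_nonneg fun ω => sq_nonneg _)] at h

theorem IsSample.measureReal_lt_abs_mulVec_sq_sub_le (hS : M.IsSample μ Zs Es εs)
    (hG : HasGaussianLaw (fun ω => (M.X ω, M.y ω)) P) (θ : Fin p → ℝ) (hu0 : 0 ≤ u)
    (hu1 : u ≤ 2 / 3) :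
    μ.real {ω | n * wNormSq M.covX θ * u <
      |(M.sampleX Zs Es ω *ᵥ θ) ⬝ᵥ (M.sampleX Zs Es ω *ᵥ θ) - n * wNormSq M.covX θ|}
      ≤ 2 * Real.exp (-(n * u ^ 2 / 8)) := by
  simpa only [zero_mul, sub_zero, integral_X_dotProduct_sq, ← dotProduct_self_eq_sum_sq]
    using hS.measureReal_lt_abs_sum_sq_sub_le hG θ 0 hu0 hu1

theorem IsSample.measureReal_lt_abs_residual_sq_sub_le (hS : M.IsSample μ Zs Es εs)
    (hG : HasGaussianLaw (fun ω => (M.X ω, M.y ω)) P) (θ : Fin p → ℝ) (hu0 : 0 ≤ u)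
    (hu1 : u ≤ 2 / 3) :
    μ.real {ω | n * M.risk θ * u <
      |(M.sampleX Zs Es ω *ᵥ θ - M.sampleY Zs εs ω) ⬝ᵥ
        (M.sampleX Zs Es ω *ᵥ θ - M.sampleY Zs εs ω) - n * M.risk θ|}
      ≤ 2 * Real.exp (-(n * u ^ 2 / 8)) := by
  simpa only [one_mul, dotProduct_self_eq_sum_sq, Pi.sub_apply, risk]
    using hS.measureReal_lt_abs_sum_sq_sub_le hG θ 1 hu0 hu1

variable {U : Matrix (Fin p) (Fin K) ℝ}

theorem IsSample.measureReal_exists_mulVec_sq_lt_le (hS : M.IsSample μ Zs Es εs)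
    (hG : HasGaussianLaw (fun ω => (M.X ω, M.y ω)) P) (hM : M.FullRank)
    (hU : IsTopEigenvectors M.covX U) (hK : 1 ≤ K) (hn : 2 ≤ n) (h : 128 * K * Real.log n < n) :
    μ.real {ω | ∃ v, ((M.sampleX Zs Es ω * whitening M.covX U) *ᵥ v) ⬝ᵥ
      ((M.sampleX Zs Es ω * whitening M.covX U) *ᵥ v) < n / 10 * (v ⬝ᵥ v)} ≤ 2 / n := by
  have : IsProbabilityMeasure μ := hS.indep.isProbabilityMeasure
  let bad (v : Fin K → ℝ) : Set Ω' := {ω | n * (v ⬝ᵥ v) * (1 / 2) <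
    |((M.sampleX Zs Es ω * whitening M.covX U) *ᵥ v) ⬝ᵥ
      ((M.sampleX Zs Es ω * whitening M.covX U) *ᵥ v) - n * (v ⬝ᵥ v)|}
  have hbad (v : Fin K → ℝ) : μ.real (bad v) ≤ 2 * Real.exp (-(n * (1 / 2) ^ 2 / 8)) := by
    simpa only [hU.wNormSq_whitening_mulVec hM.ordEig_covX_pos, Matrix.mulVec_mulVec] using
      hS.measureReal_lt_abs_mulVec_sq_sub_le hG (whitening M.covX U *ᵥ v) (u := 1 / 2)
        (by norm_num) (by norm_num)
  calc _ ≤ μ.real (⋃ v ∈ cubeGrid K (16 * K), bad v) := by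
        refine measureReal_mono (fun ω ⟨v, hv⟩ => ?_) (measure_ne_top μ _)
        by_contra hgood
        simp only [Set.mem_iUnion, not_exists] at hgood
        exact hv.not_ge (le_mulVec_sq_of_forall_mem_cubeGrid hK _ n.cast_nonneg
          (fun w hw => not_lt.1 (hgood w hw)) v)
    _ ≤ ∑ v ∈ cubeGrid K (16 * K), μ.real (bad v) := measureReal_biUnion_finset_le _ _
    _ ≤ (cubeGrid K (16 * K)).card * (2 * Real.exp (-(n * (1 / 2) ^ 2 / 8))) := by
        simpa only [nsmul_eq_mul] using Finset.sum_le_card_nsmul _ _ _ fun v _ => hbad v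
    _ ≤ 2 / n := card_cubeGrid_mul_exp_le hK hn h

theorem IsSample.measureReal_lt_sq_residual_dotProduct_col_le (hS : M.IsSample μ Zs Es εs)
    (hG : HasGaussianLaw (fun ω => (M.X ω, M.y ω)) P) (hM : M.FullRank)
    (hU : IsTopEigenvectors M.covX U) (k : Fin K) (hu0 : 0 ≤ u) (hu1 : u ≤ 2 / 3) :
    μ.real {ω | n ^ 2 * M.risk (U *ᵥ (Uᵀ *ᵥ M.bestLinear)) * u ^ 2 <
      ((M.sampleY Zs εs ω - M.sampleX Zs Es ω *ᵥ (U *ᵥ (Uᵀ *ᵥ M.bestLinear))) ⬝ᵥ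
        (M.sampleX Zs Es ω * whitening M.covX U).col k) ^ 2}
      ≤ 4 * Real.exp (-(n * u ^ 2 / 8)) := by
  have : IsProbabilityMeasure μ := hS.indep.isProbabilityMeasure
  set θ := U *ᵥ (Uᵀ *ᵥ M.bestLinear) with hθ
  have hτ : √(M.risk θ) ^ 2 = M.risk θ := Real.sq_sqrt (integral_nonneg fun ω => sq_nonneg _)
  let dir (s : ℝ) : Fin p → ℝ := θ + whitening M.covX U *ᵥ (s • Pi.single k 1)
  have hrisk {s : ℝ} (hs : s ^ 2 = M.risk θ) : M.risk (dir s) = 2 * s ^ 2 := by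
    rw [hM.risk_projection_add_whitening hU, ← hθ, ← hs, smul_dotProduct, dotProduct_smul,
      single_dotProduct, Pi.single_eq_same, smul_eq_mul, smul_eq_mul]
    ring
  have hres (s : ℝ) (ω : Ω') : M.sampleX Zs Es ω *ᵥ dir s - M.sampleY Zs εs ω =
      -(M.sampleY Zs εs ω - M.sampleX Zs Es ω *ᵥ θ -
        s • (M.sampleX Zs Es ω * whitening M.covX U).col k) := by
    rw [← Matrix.mulVec_single_one, ← Matrix.mulVec_mulVec, Matrix.mulVec_add, Matrix.mulVec_smul,
      Matrix.mulVec_smul]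
    abel
  let bad (s : ℝ) : Set Ω' := {ω | n * M.risk (dir s) * u <
    |(M.sampleX Zs Es ω *ᵥ dir s - M.sampleY Zs εs ω) ⬝ᵥ
      (M.sampleX Zs Es ω *ᵥ dir s - M.sampleY Zs εs ω) - n * M.risk (dir s)|}
  calc _ ≤ μ.real (bad √(M.risk θ) ∪ bad (-√(M.risk θ))) := by
        refine measureReal_mono (fun ω hω => ?_) (measure_ne_top μ _)
        by_contra hgood
        simp only [Set.mem_union, not_or, bad, Set.mem_ofPred_eq, not_lt] at hgood
        rw [hrisk hτ, hrisk (by rw [neg_sq, hτ]), hres, hres, neg_dotProduct_neg,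
          neg_dotProduct_neg, neg_sq, neg_smul, sub_neg_eq_add] at hgood
        rw [Set.mem_ofPred_eq, ← hτ] at hω
        refine hω.not_ge ?_
        exact sq_dotProduct_le_of_abs_sub_le hgood.2 hgood.1
    _ ≤ μ.real (bad √(M.risk θ)) + μ.real (bad (-√(M.risk θ))) := measureReal_union_le _ _
    _ ≤ 2 * Real.exp (-(n * u ^ 2 / 8)) + 2 * Real.exp (-(n * u ^ 2 / 8)) :=
        add_le_add (hS.measureReal_lt_abs_residual_sq_sub_le hG _ hu0 hu1)
          (hS.measureReal_lt_abs_residual_sq_sub_le hG _ hu0 hu1)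
    _ = 4 * Real.exp (-(n * u ^ 2 / 8)) := by ring

theorem IsSample.measureReal_exists_lt_sq_residual_dotProduct_col_le (hS : M.IsSample μ Zs Es εs)
    (hG : HasGaussianLaw (fun ω => (M.X ω, M.y ω)) P) (hM : M.FullRank)
    (hU : IsTopEigenvectors M.covX U) (hn : 0 < n) (hKn : K ≤ n) (hlog : 36 * Real.log n ≤ n) :
    μ.real {ω | ∃ k, n ^ 2 * M.risk (U *ᵥ (Uᵀ *ᵥ M.bestLinear)) * (16 * Real.log n / n) <
      ((M.sampleY Zs εs ω - M.sampleX Zs Es ω *ᵥ (U *ᵥ (Uᵀ *ᵥ M.bestLinear))) ⬝ᵥ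
        (M.sampleX Zs Es ω * whitening M.covX U).col k) ^ 2} ≤ 4 / n := by
  have : IsProbabilityMeasure μ := hS.indep.isProbabilityMeasure
  have hn' : (0 : ℝ) < n := by exact_mod_cast hn
  have hu : √(16 * Real.log n / n) ^ 2 = 16 * Real.log n / n :=
    Real.sq_sqrt (div_nonneg (mul_nonneg (by norm_num) (Real.log_natCast_nonneg n)) hn'.le)
  have hu1 : √(16 * Real.log n / n) ≤ 2 / 3 := by
    refine Real.sqrt_le_iff.2 ⟨by norm_num, ?_⟩
    rw [div_le_iff₀ hn']
    linarith
  have hcol (k : Fin K) := hS.measureReal_lt_sq_residual_dotProduct_col_le hG hM hU k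
    (Real.sqrt_nonneg _) hu1
  have hexp : 4 * Real.exp (-(n * (16 * Real.log n / n) / 8)) = 4 / (n : ℝ) ^ 2 := by
    rw [show (16 : ℝ) = 8 * (2 : ℕ) by norm_num, exp_neg_mul_log_div hn', mul_one_div]
  simp only [hu, hexp] at hcol
  rw [Set.ofPred_exists]
  calc _ ≤ ∑ _k : Fin K, 4 / (n : ℝ) ^ 2 :=
        (measureReal_iUnion_fintype_le _).trans (Finset.sum_le_sum fun k _ => hcol k)
    _ = K * 4 / (n : ℝ) ^ 2 := by simp [mul_div_assoc]
    _ ≤ n * 4 / (n : ℝ) ^ 2 := by gcongr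
    _ = 4 / n := by field_simp

theorem IsSample.measureReal_lt_pcrRisk_le (hS : M.IsSample μ Zs Es εs)
    (hG : HasGaussianLaw (fun ω => (M.X ω, M.y ω)) P) (hM : M.FullRank)
    (hU : IsTopEigenvectors M.covX U) (hK : 1 ≤ K) (hn : 2 ≤ n) (h : 128 * K * Real.log n < n) :
    μ.real {ω | M.risk (U *ᵥ (Uᵀ *ᵥ M.bestLinear)) * (1 + 1600 * (K * Real.log n / n)) <
      M.pcrRisk U Zs Es εs ω} ≤ 6 / n := by
  have : IsProbabilityMeasure μ := hS.indep.isProbabilityMeasure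
  have hK' : (1 : ℝ) ≤ K := by exact_mod_cast hK
  have hlog : 1 / 2 ≤ Real.log n := half_le_log (by exact_mod_cast hn)
  have hKn : K ≤ n := by exact_mod_cast (show (K : ℝ) ≤ n by nlinarith)
  let low : Set Ω' := {ω | ∃ v, ((M.sampleX Zs Es ω * whitening M.covX U) *ᵥ v) ⬝ᵥ
    ((M.sampleX Zs Es ω * whitening M.covX U) *ᵥ v) < n / 10 * (v ⬝ᵥ v)}
  let corr : Set Ω' := {ω | ∃ k,
    n ^ 2 * M.risk (U *ᵥ (Uᵀ *ᵥ M.bestLinear)) * (16 * Real.log n / n) <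
      ((M.sampleY Zs εs ω - M.sampleX Zs Es ω *ᵥ (U *ᵥ (Uᵀ *ᵥ M.bestLinear))) ⬝ᵥ
        (M.sampleX Zs Es ω * whitening M.covX U).col k) ^ 2}
  calc _ ≤ μ.real (low ∪ corr) := by
        refine measureReal_mono (fun ω hω => ?_) (measure_ne_top μ _)
        by_contra hgood
        simp only [Set.mem_union, not_or, not_exists, low, corr, Set.mem_ofPred_eq,
          not_lt] at hgood
        refine (Set.mem_ofPred_eq ▸ hω).not_ge <|
          (hM.risk_pcrEstimator_le hU (by omega) _ _ hgood.1 hgood.2).trans_eq ?_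
        ring
    _ ≤ μ.real low + μ.real corr := measureReal_union_le _ _
    _ ≤ 2 / n + 4 / n :=
        add_le_add (hS.measureReal_exists_mulVec_sq_lt_le hG hM hU hK hn h)
          (hS.measureReal_exists_lt_sq_residual_dotProduct_col_le hG hM hU (by omega) hKn
            (by nlinarith))
    _ = 6 / n := by ring

end FactorModel

end

section

/-! ### The excess risk bounds -/

variable {Ω : Type*} [MeasurableSpace Ω] {P : Measure Ω} {p K : ℕ} {M : FactorModel P p K}
  {C Q r r' ℓ : ℝ}

/-- The four excess risk bounds of the theorem for a risk `Q`, with constant `C`. The parameter `r`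
multiplies the bias terms and `ℓ` the variance terms; the theorem has `r = p / n` and
`ℓ = K log n / n`. -/
def FactorModel.ExcessRiskBounds (M : FactorModel P p K) (C r ℓ Q : ℝ) : Prop :=
  (Q - M.risk M.bestLinear ≤
    C * (opNorm M.covE * ‖WithLp.toLp 2 M.bestLinear‖ ^ 2 * r + M.risk M.bestLinear * ℓ)) ∧
  (Q - M.noiseVar ≤
    C * ((1 + M.snr⁻¹) * opNorm M.covE * ‖WithLp.toLp 2 M.bestLinear‖ ^ 2 * r
      + M.risk M.bestLinear * ℓ)) ∧
  (M.covE = 0 → Q - M.noiseVar ≤ C * (M.noiseVar * ℓ)) ∧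
  (0 < ordEig M.covE p → Q - M.noiseVar ≤
    C * (condNumber M.covE * (wNormSq M.covZ M.β / M.snr) * r + M.noiseVar * ℓ))

namespace FactorModel

variable [IsProbabilityMeasure P]

theorem ExcessRiskBounds.mono (h : M.ExcessRiskBounds C r ℓ Q) (hC : 0 ≤ C) (hr : r ≤ r') :
    M.ExcessRiskBounds C r' ℓ Q := by
  obtain ⟨hbest, hnoise, hzero, hpos⟩ := h
  have hE := opNorm_nonneg M.covE
  have hsnr := M.snr_nonneg
  have hcond := condNumber_nonneg M.posSemidef_covE
  have hβ := wNormSq_nonneg M.posSemidef_covZ M.β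
  exact ⟨hbest.trans (by gcongr), hnoise.trans (by gcongr), hzero,
    fun hp => (hpos hp).trans (by gcongr)⟩

theorem FullRank.sub_risk_bestLinear_le (hM : M.FullRank) {U : Matrix (Fin p) (Fin K) ℝ}
    (hU : IsTopEigenvectors M.covX U)
    (hQ : Q ≤ M.risk (U *ᵥ (Uᵀ *ᵥ M.bestLinear)) * (1 + 1600 * ℓ)) (hℓ0 : 0 ≤ ℓ)
    (hℓ1 : ℓ ≤ 1 / 128) :
    Q - M.risk M.bestLinear ≤
      1600 * (opNorm M.covE * (M.bestLinear ⬝ᵥ M.bestLinear) + M.risk M.bestLinear * ℓ) := by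
  have hbias := mul_nonneg (opNorm_nonneg M.covE) (dotProduct_self_nonneg M.bestLinear)
  have hle := hQ.trans (mul_le_mul_of_nonneg_right (hM.risk_projection_le hU) (by positivity))
  nlinarith

theorem FullRank.excessRiskBounds_of_le (hM : M.FullRank) (hK : 1 ≤ K)
    {U : Matrix (Fin p) (Fin K) ℝ} (hU : IsTopEigenvectors M.covX U)
    (hQ : Q ≤ M.risk (U *ᵥ (Uᵀ *ᵥ M.bestLinear)) * (1 + 1600 * ℓ)) (hℓ0 : 0 ≤ ℓ)
    (hℓ1 : ℓ ≤ 1 / 128) : M.ExcessRiskBounds 2000 1 ℓ Q := by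
  have hbest := hM.sub_risk_bestLinear_le hU hQ hℓ0 hℓ1
  have horacle := hM.risk_bestLinear_sub_noiseVar_le hK
  have hbias := mul_nonneg (opNorm_nonneg M.covE) (dotProduct_self_nonneg M.bestLinear)
  have hsnr_bias := mul_nonneg (inv_nonneg.2 M.snr_nonneg) hbias
  have hnoise : 0 ≤ M.noiseVar := variance_nonneg _ _
  have hnoise_risk := M.noiseVar_le_risk M.bestLinear
  have hvar : 0 ≤ M.risk M.bestLinear * ℓ := mul_nonneg (hnoise.trans hnoise_risk) hℓ0
  have hnoise_var : 0 ≤ M.noiseVar * ℓ := mul_nonneg hnoise hℓ0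
  simp only [ExcessRiskBounds, norm_toLp_sq, mul_one]
  refine ⟨by linarith, by linarith, fun hE => ?_, fun hE => ?_⟩
  · have hopNorm : opNorm M.covE = 0 := by simp [hE, opNorm]
    rw [hopNorm, mul_zero, zero_mul] at horacle
    have hrisk : M.risk M.bestLinear = M.noiseVar := by linarith
    rw [hopNorm, zero_mul, hrisk] at hbest
    linarith
  · have hsnr := hM.risk_bestLinear_sub_noiseVar_le_snr hK
    have hcond : wNormSq M.covZ M.β / M.snr
        ≤ condNumber M.covE * (wNormSq M.covZ M.β / M.snr) :=
      le_mul_of_one_le_left (by linarith)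
        (one_le_condNumber M.posSemidef_covE.1 (hK.trans hU.le) hE)
    have hrisk : M.risk M.bestLinear * ℓ
        ≤ M.noiseVar * ℓ + wNormSq M.covZ M.β / M.snr * (1 / 128) := by
      nlinarith
    linarith [hM.opNorm_mul_bestLinear_sq_le hK hE]

end FactorModel

end

theorem ofReal_one_sub_le_measure_le {Ω : Type*} [MeasurableSpace Ω] {μ : Measure Ω}
    [IsProbabilityMeasure μ] {f : Ω → ℝ} {b δ : ℝ} (h : μ.real {ω | b < f ω} ≤ δ) :
    ENNReal.ofReal (1 - δ) ≤ μ {ω | f ω ≤ b} := by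
  rw [← ofReal_measureReal]
  refine ENNReal.ofReal_le_ofReal ?_
  have hcover : {ω | f ω ≤ b} ∪ {ω | b < f ω} = Set.univ := by
    ext ω
    simp [le_or_gt]
  have hunion := measureReal_union_le (μ := μ) {ω | f ω ≤ b} {ω | b < f ω}
  rw [hcover, probReal_univ] at hunion
  linarith

theorem mainTheorem5_general :
    ∃ C c C' : ℝ, 0 < C ∧ 0 < c ∧ 0 < C' ∧
      ∀ (n p K : ℕ), 1 ≤ K → C * K * Real.log n < n →
      ∀ {Ω : Type*} [MeasurableSpace Ω] (P : Measure Ω) [IsProbabilityMeasure P]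
        (M : FactorModel P p K),
        HasGaussianLaw (fun ω => (M.X ω, M.y ω)) P → M.FullRank →
      ∀ (U : Matrix (Fin p) (Fin K) ℝ), IsTopEigenvectors M.covX U →
      ∀ {Ω' : Type*} [MeasurableSpace Ω'] (μ : Measure Ω') [IsProbabilityMeasure μ]
        (Zs : Fin n → Ω' → Fin K → ℝ) (Es : Fin n → Ω' → Fin p → ℝ) (εs : Fin n → Ω' → ℝ),
        M.IsSample μ Zs Es εs →
        ENNReal.ofReal (1 - c / n) ≤ μ {ω |
          M.ExcessRiskBounds C' 1 (K * Real.log n / n) (M.pcrRisk U Zs Es εs ω)} := by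
  refine ⟨128, 6, 2000, by norm_num, by norm_num, by norm_num,
    fun n p K hK hn Ω _ P _ M hG hM U hU Ω' _ μ _ Zs Es εs hS => ?_⟩
  have hn0 : 0 < n := Nat.pos_of_ne_zero (by rintro rfl; simp at hn)
  have hn0' : (1 : ℝ) ≤ n := by exact_mod_cast hn0
  obtain rfl | hn2 : n = 1 ∨ 2 ≤ n := by omega
  · exact (ENNReal.ofReal_eq_zero.2 (by norm_num)).trans_le zero_le
  refine (ofReal_one_sub_le_measure_le (hS.measureReal_lt_pcrRisk_le hG hM hU hK hn2 hn)).trans <|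
    measure_mono fun ω hω => hM.excessRiskBounds_of_le hK hU hω ?_ ?_
  · have := Real.log_nonneg hn0'
    positivity
  · rw [div_le_iff₀ (by linarith)]
    linarith

theorem mainTheorem5 :
    ∃ C c C' : ℝ, 0 < C ∧ 0 < c ∧ 0 < C' ∧
      ∀ (n p K : ℕ), 1 ≤ K → n < p → C * K * Real.log n < n →
      ∀ {Ω : Type*} [MeasurableSpace Ω] (P : Measure Ω) [IsProbabilityMeasure P]
        (M : FactorModel P p K),
        HasGaussianLaw (fun ω => (M.X ω, M.y ω)) P → M.FullRank →
      ∀ (U : Matrix (Fin p) (Fin K) ℝ), IsTopEigenvectors M.covX U →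
      ∀ {Ω' : Type*} [MeasurableSpace Ω'] (μ : Measure Ω') [IsProbabilityMeasure μ]
        (Zs : Fin n → Ω' → Fin K → ℝ) (Es : Fin n → Ω' → Fin p → ℝ) (εs : Fin n → Ω' → ℝ),
        M.IsSample μ Zs Es εs →
        ENNReal.ofReal (1 - c / n) ≤ μ {ω |
          -- excess risk over the best linear predictor
          (M.pcrRisk U Zs Es εs ω - M.risk M.bestLinear ≤
            C' * (opNorm M.covE * ‖WithLp.toLp 2 M.bestLinear‖ ^ 2 * (p / n)
              + M.risk M.bestLinear * (K * Real.log n / n))) ∧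
          -- excess risk over the oracle risk; here `M.snr⁻¹ = 0` if `Σ_E = 0`
          (M.pcrRisk U Zs Es εs ω - M.noiseVar ≤
            C' * ((1 + M.snr⁻¹) * opNorm M.covE * ‖WithLp.toLp 2 M.bestLinear‖ ^ 2 * (p / n)
              + M.risk M.bestLinear * (K * Real.log n / n))) ∧
          -- noiseless features
          (M.covE = 0 →
            M.pcrRisk U Zs Es εs ω - M.noiseVar ≤
              C' * (M.noiseVar * (K * Real.log n / n))) ∧
          -- non-degenerate feature noise
          (0 < ordEig M.covE p →
            M.pcrRisk U Zs Es εs ω - M.noiseVar ≤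
              C' * (condNumber M.covE * (wNormSq M.covZ M.β / M.snr) * (p / n)
                + M.noiseVar * (K * Real.log n / n)))} := by
  obtain ⟨C, c, C', hC, hc, hC', h⟩ := mainTheorem5_general
  refine ⟨C, c, C', hC, hc, hC', fun n p K hK hnp hn Ω _ P _ M hG hM U hU Ω' _ μ _ Zs Es εs hS =>
    (h n p K hK hn P M hG hM U hU μ Zs Es εs hS).trans (measure_mono fun ω hω => ?_)⟩
  have hn0 : 0 < n := Nat.pos_of_ne_zero (by rintro rfl; simp at hn)
  exact hω.mono hC'.le ((one_le_div (by exact_mod_cast hn0)).2 (by exact_mod_cast hnp.le))
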